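/- Let $M=M^9\subset\mathbb{C}^5$ be a real-analytic real hypersurface through the origin whose Levi form has signature $(2,2)$ at every point. Write $T^cM=TM\cap J(TM)$, where $J$ is the complex structure of $\mathbb{C}^5$. **Coframe.** Let $W\subset\mathbb{C}^5$ be open (for instance $W\supset M$), let $\rho$ be a real-analytic function on $W$ with $M\cap W=\{\rho=0\}$ and $d\rho\neq0$ on $M\cap W$, and let $\theta=\sqrt{-1}\,\bar\partial\rho|_M$ be the corresponding contact form. Let $\alpha^1,\dots,\alpha^4$ be smooth complex one-forms on $W$, restricted to $M$, which vanish on $T^{0,1}M$, are linearly independent on $T^{1,0}M$, and satisfy $$d\theta\equiv\sqrt{-1}\,(\alpha^1\wedge\bar\alpha^1+\alpha^2\wedge\bar\alpha^2-\alpha^3\wedge\bar\alpha^3-\alpha^4\wedge\bar\alpha^4)\pmod\theta\quad\text{on } M\cap W .$$ **Torsion functions.** For $x\in M\cap W$ and $U=\begin{pmatrix}P&Q\\R&S\end{pmatrix}\in U(2)$ put $\omega^0=\theta$, $\omega^3=\alpha^3-P\alpha^1-Q\alpha^2$, $\omega^4=\alpha^4-R\alpha^1-S\alpha^2$, and let $\mathcal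 I$ be the algebraic ideal generated by $\omega^0,\omega^3,\omega^4,\bar\omega^3,\bar\omega^4$. The torsion functions are complex-valued functions $A,\dots,J$ on $(M\cap W)\times U(2)$ such that $$U^*\begin{pmatrix}d\alpha^3\\d\alpha^4\end{pmatrix}-\begin{pmatrix}d\alpha^1\\d\alpha^2\end{pmatrix}\equiv\begin{pmatrix}A\,\alpha^1\wedge\bar\alpha^1+B\,\alpha^1\wedge\bar\alpha^2+C\,\alpha^2\wedge\bar\alpha^1+D\,\alpha^2\wedge\bar\alpha^2+E\,\alpha^1\wedge\alpha^2\\F\,\alpha^1\wedge\bar\alpha^1+G\,\alpha^1\wedge\bar\alpha^2+H\,\alpha^2\wedge\bar\alpha^1+I\,\alpha^2\wedge\bar\alpha^2+J\,\alpha^1\wedge\alpha^2\end{pmatrix}\pmod{\mathcal I}.$$ **Immersion and lift.** Let $\varphi:\mathbb{D}^2\to M$ be a holomorphic immersion of the open unit bidisk with $\varphi(0)=0$, in the following sense: $\varphi$ is a smooth immersion such that, for every $y\in\mathbb{D}^2$, the plane $\varphi_*T_y\mathbb{D}^2$ is $J$-invariant and contained in $T^c_{\varphi(y)}M$. (This holds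 for every holomorphic map $\mathbb{D}^2\to\mathbb{C}^5$ with values in $M$ and injective differential.) A lift of $\varphi$ is a map $\tilde\varphi(y)=(\varphi(y),U(y))\in (M\cap W)\times U(2)$, defined for $y\in\mathbb{D}^2\cap\varphi^{-1}(W)$, with $\tilde\varphi^*\omega^3=\tilde\varphi^*\omega^4=0$. **Theorem.** 1. The torsion functions $A,\dots,J$ exist and are unique on $(M\cap W)\times U(2)$. 2. The lift $\tilde\varphi$ exists, is unique, and is smooth. At each point, if $f,g$ are two values of $\varphi_*$ on real tangent vectors of $\mathbb{D}^2$ that are linearly independent over $\mathbb{C}$, with components $f_i=\alpha^i(f)$ and $g_i=\alpha^i(g)$, then $\begin{pmatrix}f_1&g_1\\f_2&g_2\end{pmatrix}$ is invertible and $$U=\begin{pmatrix}f_3&g_3\\f_4&g_4\end{pmatrix}\begin{pmatrix}f_1&g_1\\f_2&g_2\end{pmatrix}^{-1}.$$ 3. The image of $\tilde\varphi$ lies in the common zero set of the two complex-valued functions $$T_1=\bar B+E-\bar F,\qquad T_2=\bar D+J-\bar H .$$ -/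

import Mathlib

open scoped ContDiff

noncomputable section

namespace CRBidisk

/-- Complex five-space `ℂ⁵`, with its complex structure `v ↦ Complex.I • v`. -/
abbrev C5 : Type := Fin 5 → ℂ

/-- Complex-valued real-linear covectors on `ℂ⁵` (elements of `ℂ ⊗ T*ℂ⁵`). -/
abbrev Cov : Type := C5 →L[ℝ] ℂ

/-- The open bidisk `𝔻 × 𝔻` in `ℂ²`. -/
def bidisk : Set (ℂ × ℂ) := {y | ‖y.1‖ < 1 ∧ ‖y.2‖ < 1}

/-! ### Exterior calculus of complex-valued one-forms on open subsets of `ℂ⁵` -/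

/-- The complex conjugate covector. -/
def conjCov (a : Cov) : Cov := (Complex.conjCLE : ℂ →L[ℝ] ℂ).comp a

/-- The wedge product of two covectors: `(a ∧ b)(v, w) = a(v) b(w) - a(w) b(v)`. -/
def wedge (a b : Cov) (v w : C5) : ℂ := a v * b w - a w * b v

/-- The exterior derivative `dβ` of a one-form `β`, at the point `z`, on the vectors `v, w`. -/
def dForm (β : C5 → Cov) (z v w : C5) : ℂ :=
  extDeriv (fun x => ContinuousAlternatingMap.ofSubsingleton ℝ C5 ℂ (0 : Fin 1) (β x)) z ![v, w]

/-- The exterior derivative of a one-form in coordinates. -/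
theorem dForm_apply {β : C5 → Cov} {z : C5} (h : DifferentiableAt ℝ β z) (v w : C5) :
    dForm β z v w = fderiv ℝ β z v w - fderiv ℝ β z w v := by
  have hd : DifferentiableAt ℝ
      (fun x => ContinuousAlternatingMap.ofSubsingleton ℝ C5 ℂ (0 : Fin 1) (β x)) z :=
    ((ContinuousAlternatingMap.ofSubsingletonLIE (𝕜 := ℝ) (E := C5) (F := ℂ)
      (0 : Fin 1)).toContinuousLinearEquiv.differentiable.differentiableAt).comp z h
  have e : ∀ u x : C5, fderiv ℝ (fun y => β y u) z x = fderiv ℝ β z x u := by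
    intro u x
    rw [fderiv_clm_apply h (differentiableAt_const u)]
    simp
  rw [dForm, extDeriv_apply hd]
  simp [Fin.sum_univ_two, Fin.removeNth, e, sub_eq_add_neg]

/-- `Ψ ≡ Ψ'` on the real tangent space `T`, modulo the algebraic ideal of the exterior algebra
that is generated by the one-forms `Ω 0, …, Ω (n - 1)`: the restriction of `Ψ - Ψ'` to `T` is a
sum `∑ η k ∧ Ω k`. (Every one-form on `T` is the restriction of a covector of `ℂ⁵`.) -/
def CongrMod {n : ℕ} (T : Submodule ℝ C5) (Ω : Fin n → Cov) (Ψ Ψ' : C5 → C5 → ℂ) : Prop :=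
  ∃ η : Fin n → Cov, ∀ v ∈ T, ∀ w ∈ T, Ψ v w - Ψ' v w = ∑ k, wedge (η k) (Ω k) v w

/-! ### Real-analytic hypersurfaces, contact form, Levi form -/

/-- `ρ` is a real-analytic defining function of `M` in the open set `W`. -/
structure IsDefiningFunctionOn (M W : Set C5) (ρ : C5 → ℝ) : Prop where
  isOpen : IsOpen W
  analytic : AnalyticOnNhd ℝ ρ W
  mem_iff : ∀ z ∈ W, z ∈ M ↔ ρ z = 0
  fderiv_ne : ∀ z ∈ W, z ∈ M → fderiv ℝ ρ z ≠ 0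

/-- `M` is an (embedded) real-analytic real hypersurface of `ℂ⁵`. -/
def IsRealAnalyticHypersurface (M : Set C5) : Prop :=
  ∀ p ∈ M, ∃ (W : Set C5) (ρ : C5 → ℝ), p ∈ W ∧ IsDefiningFunctionOn M W ρ

/-- The real tangent space `T_z M` of `M = {ρ = 0}`. -/
def tangent (ρ : C5 → ℝ) (z : C5) : Submodule ℝ C5 := LinearMap.ker (fderiv ℝ ρ z : C5 →ₗ[ℝ] ℝ)

/-- The complex tangent space `T^c_z M = T_z M ∩ J (T_z M)` of `M = {ρ = 0}`; for points of the
hypersurface it is the kernel of the contact form on `T_z M`. -/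
def complexTangent (ρ : C5 → ℝ) (z : C5) : Submodule ℂ C5 where
  carrier := {v | fderiv ℝ ρ z v = 0 ∧ fderiv ℝ ρ z (Complex.I • v) = 0}
  zero_mem' := by simp
  add_mem' := by
    rintro a b ⟨ha, ha'⟩ ⟨hb, hb'⟩
    exact ⟨by simp [ha, hb], by simp [ha', hb']⟩
  smul_mem' := by
    rintro c v ⟨h, h'⟩
    have key : ∀ a b : ℝ, ∀ x y : C5, fderiv ℝ ρ z x = 0 → fderiv ℝ ρ z y = 0 →
        fderiv ℝ ρ z (a • x + b • y) = 0 := by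
      intro a b x y hx hy
      simp [hx, hy]
    constructor
    · have e : c • v = c.re • v + c.im • (Complex.I • v) := by
        ext i
        simp only [Pi.add_apply, Pi.smul_apply, smul_eq_mul, Complex.real_smul]
        conv_lhs => rw [← Complex.re_add_im c]
        ring
      rw [e]
      exact key _ _ _ _ h h'
    · have e : Complex.I • c • v = (-c.im) • v + c.re • (Complex.I • v) := by
        ext i
        simp only [Pi.add_apply, Pi.smul_apply, smul_eq_mul, Complex.real_smul]
        conv_lhs => rw [← Complex.re_add_im c]
        push_cast
        linear_combination (c.im * v i : ℂ) * Complex.I_mul_I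
      rw [e]
      exact key _ _ _ _ h h'

/-- The one-form `θ = i ∂̄ρ` where `∂̄ρ(v) = (dρ(v) + i dρ(i v)) / 2`. Its restriction to the
tangent spaces of `{ρ = 0}` is real-valued: it is the contact form. -/
def theta (ρ : C5 → ℝ) (z : C5) : Cov :=
  Complex.I • (1 / 2 : ℂ) •
    (Complex.ofRealCLM.comp (fderiv ℝ ρ z) + Complex.I •
      Complex.ofRealCLM.comp ((fderiv ℝ ρ z).comp (Complex.I • ContinuousLinearMap.id ℝ C5)))

/-- The quadratic form of the Levi form: for `v ∈ T^c_z M` and the associated vector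
`X = (v - i J v) / 2` of type `(1,0)`, one has `-i dθ(X, X̄) = dθ(v, J v) / 2`, which is real. -/
def leviQuad (ρ : C5 → ℝ) (z v : C5) : ℝ := (dForm (theta ρ) z v (Complex.I • v)).re / 2

/-- The Levi form of `M = {ρ = 0}` has signature `(2,2)` at `z`: on the four-dimensional complex
vector space `T^c_z M`, it is positive definite on some complex plane and negative definite on
another one. -/
def LeviSignature22 (ρ : C5 → ℝ) (z : C5) : Prop :=
  ∃ P N : Submodule ℂ C5,
    P ≤ complexTangent ρ z ∧ N ≤ complexTangent ρ z ∧
    Module.finrank ℂ P = 2 ∧ Module.finrank ℂ N = 2 ∧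
    (∀ v ∈ P, v ≠ 0 → 0 < leviQuad ρ z v) ∧ (∀ v ∈ N, v ≠ 0 → leviQuad ρ z v < 0)

/-- The Levi form of `M` has signature `(2,2)` at each point of `M`, with respect to a local
defining function (another choice of it multiplies the Levi form by a nonzero real number, which
does not affect signature `(2,2)`). -/
def HasLeviSignature22 (M : Set C5) : Prop :=
  ∀ p ∈ M, ∃ (W : Set C5) (ρ : C5 → ℝ),
    p ∈ W ∧ IsDefiningFunctionOn M W ρ ∧ LeviSignature22 ρ p

/-! ### Adapted coframes -/

/-- The one-forms `α¹, …, α⁴` (numbered `0, …, 3` here) on the open set `W` restrict on `M ∩ W`,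
where `M = {ρ = 0}`, to a coframe of the bundle dual to `T^{1,0}M` which diagonalises the Levi
form: `dθ ≡ i (α¹ ∧ ᾱ¹ + α² ∧ ᾱ² - α³ ∧ ᾱ³ - α⁴ ∧ ᾱ⁴) mod θ`. Only the restrictions of the forms
to the tangent spaces of `M` matter. -/
structure IsAdaptedCoframe (M W : Set C5) (ρ : C5 → ℝ) (α : Fin 4 → C5 → Cov) : Prop where
  smooth : ∀ i, ContDiffOn ℝ ∞ (α i) W
  /-- the forms vanish on `T^{0,1}M`, i.e. they are complex linear on `T^c M` -/
  type10 : ∀ z ∈ M ∩ W, ∀ i, ∀ v ∈ complexTangent ρ z, α i z (Complex.I • v) = Complex.I * α i z v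
  /-- they are linearly independent on the four-dimensional space `T^{1,0}M ≅ T^c M` -/
  coframe : ∀ z ∈ M ∩ W, ∀ v ∈ complexTangent ρ z, (∀ i, α i z v = 0) → v = 0
  levi : ∀ z ∈ M ∩ W, CongrMod (tangent ρ z) ![theta ρ z] (dForm (theta ρ) z)
    (fun v w => Complex.I *
      (wedge (α 0 z) (conjCov (α 0 z)) v w + wedge (α 1 z) (conjCov (α 1 z)) v w
        - wedge (α 2 z) (conjCov (α 2 z)) v w - wedge (α 3 z) (conjCov (α 3 z)) v w))

/-! ### The Pfaffian system on `M × U(2)` and its torsion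

A point of the fibre is a unitary matrix `U = (P Q; R S)`. -/

/-- `ω³ = α³ - P α¹ - Q α²` at the point `(z, U)`. -/
def omega3 (α : Fin 4 → C5 → Cov) (z : C5) (U : Matrix (Fin 2) (Fin 2) ℂ) : Cov :=
  α 2 z - U 0 0 • α 0 z - U 0 1 • α 1 z

/-- `ω⁴ = α⁴ - R α¹ - S α²` at the point `(z, U)`. -/
def omega4 (α : Fin 4 → C5 → Cov) (z : C5) (U : Matrix (Fin 2) (Fin 2) ℂ) : Cov :=
  α 3 z - U 1 0 • α 0 z - U 1 1 • α 1 z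

/-- The generators `ω⁰ = θ, ω³, ω⁴, ω̄³, ω̄⁴` of the ideal `𝓘`. -/
def idealGens (ρ : C5 → ℝ) (α : Fin 4 → C5 → Cov) (z : C5) (U : Matrix (Fin 2) (Fin 2) ℂ) :
    Fin 5 → Cov :=
  ![theta ρ z, omega3 α z U, omega4 α z U, conjCov (omega3 α z U), conjCov (omega4 α z U)]

/-- The values of the ten torsion coefficients. -/
structure Torsion where
  (A B C D E F G H I J : ℂ)

/-- The component `k` (`k = 0, 1`) of the column `U* (dα³, dα⁴)ᵀ - (dα¹, dα²)ᵀ` of two-forms. -/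
def torsionForm (α : Fin 4 → C5 → Cov) (z : C5) (U : Matrix (Fin 2) (Fin 2) ℂ) (k : Fin 2)
    (v w : C5) : ℂ :=
  star U k 0 * dForm (α 2) z v w + star U k 1 * dForm (α 3) z v w
    - dForm (![α 0, α 1] k) z v w

/-- The two-form
`a α¹ ∧ ᾱ¹ + b α¹ ∧ ᾱ² + c α² ∧ ᾱ¹ + d α² ∧ ᾱ² + e α¹ ∧ α²`. -/
def combo (α : Fin 4 → C5 → Cov) (z : C5) (a b c d e : ℂ) (v w : C5) : ℂ :=
  a * wedge (α 0 z) (conjCov (α 0 z)) v w + b * wedge (α 0 z) (conjCov (α 1 z)) v w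
    + c * wedge (α 1 z) (conjCov (α 0 z)) v w + d * wedge (α 1 z) (conjCov (α 1 z)) v w
    + e * wedge (α 0 z) (α 1 z) v w

/-- `t : M × U(2) → ℂ¹⁰` are the torsion functions `A, …, J` over `M ∩ W`: modulo `𝓘`, the column
`U* (dα³, dα⁴)ᵀ - (dα¹, dα²)ᵀ` has the entries
`A α¹∧ᾱ¹ + B α¹∧ᾱ² + C α²∧ᾱ¹ + D α²∧ᾱ² + E α¹∧α²` and
`F α¹∧ᾱ¹ + G α¹∧ᾱ² + H α²∧ᾱ¹ + I α²∧ᾱ² + J α¹∧α²`. -/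
def IsTorsion (M W : Set C5) (ρ : C5 → ℝ) (α : Fin 4 → C5 → Cov)
    (t : C5 → Matrix (Fin 2) (Fin 2) ℂ → Torsion) : Prop :=
  ∀ z ∈ M ∩ W, ∀ U ∈ Matrix.unitaryGroup (Fin 2) ℂ,
    CongrMod (tangent ρ z) (idealGens ρ α z U) (torsionForm α z U 0)
      (combo α z (t z U).A (t z U).B (t z U).C (t z U).D (t z U).E) ∧
    CongrMod (tangent ρ z) (idealGens ρ α z U) (torsionForm α z U 1)
      (combo α z (t z U).F (t z U).G (t z U).H (t z U).I (t z U).J)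

/-- `T₁ = B̄ + E - F̄`. -/
def T1 (t : Torsion) : ℂ := star t.B + t.E - star t.F

/-- `T₂ = D̄ + J - H̄`. -/
def T2 (t : Torsion) : ℂ := star t.D + t.J - star t.H

/-! ### Holomorphic immersions of the bidisk and their lifts -/

/-- A holomorphic immersion of the bidisk into `M`: an immersion of manifolds whose tangent planes
are invariant under the complex structure and contained in `T^c M`. (Every holomorphic map from the
bidisk to `ℂ⁵` with values in `M` and with injective differential is one.) -/
structure IsHolomorphicImmersion (M : Set C5) (φ : ℂ × ℂ → C5) : Prop where
  mapsTo : Set.MapsTo φ bidisk M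
  smooth : ContDiffOn ℝ ∞ φ bidisk
  immersive : ∀ y ∈ bidisk, Function.Injective (fderiv ℝ φ y)
  invariant : ∀ y ∈ bidisk, ∀ v, ∃ w, fderiv ℝ φ y w = Complex.I • fderiv ℝ φ y v
  tangent : ∀ y ∈ bidisk, ∀ (W : Set C5) (ρ : C5 → ℝ), φ y ∈ W → IsDefiningFunctionOn M W ρ →
    ∀ v, fderiv ℝ φ y v ∈ complexTangent ρ (φ y)

/-- `y ↦ (φ y, U y)` is a lift of `φ` to `M × U(2)` over the part of the bidisk which `φ` maps to
the domain `W` of the coframe: `U y` is unitary, and the lift pulls `ω³` and `ω⁴` back to zero. -/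
def IsLift (W : Set C5) (α : Fin 4 → C5 → Cov) (φ : ℂ × ℂ → C5)
    (U : ℂ × ℂ → Matrix (Fin 2) (Fin 2) ℂ) : Prop :=
  ∀ y ∈ bidisk ∩ φ ⁻¹' W, U y ∈ Matrix.unitaryGroup (Fin 2) ℂ ∧
    ∀ v, omega3 α (φ y) (U y) (fderiv ℝ φ y v) = 0 ∧ omega4 α (φ y) (U y) (fderiv ℝ φ y v) = 0

/-- The matrix `(f₁ g₁; f₂ g₂)` of the values of `α¹, α²` on the two vectors `f, g`. -/
def upperMatrix (α : Fin 4 → C5 → Cov) (z f g : C5) : Matrix (Fin 2) (Fin 2) ℂ :=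
  !![α 0 z f, α 0 z g; α 1 z f, α 1 z g]

/-- The matrix `(f₃ g₃; f₄ g₄)` of the values of `α³, α⁴` on the two vectors `f, g`. -/
def lowerMatrix (α : Fin 4 → C5 → Cov) (z f g : C5) : Matrix (Fin 2) (Fin 2) ℂ :=
  !![α 2 z f, α 2 z g; α 3 z f, α 3 z g]

end CRBidisk

end

namespace CRBidisk

/-! ### Functions vanishing on a hypersurface -/

section Hypersurface

variable {M W : Set C5} {ρ : C5 → ℝ} {z : C5}

/-! Torsion functions. Modulo `𝓘`, a two-form is its restriction to the complex plane cut out by θ,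
ω³, ω⁴, where α¹, α² are coordinates (`congrMod_idealGens_iff`). A two-form on such a plane has six
coefficients. The one at ᾱ¹∧ᾱ² vanishes because the dαⁱ have no (0,2)-part on T^cM
(`dForm_integrable`). The other five exist by `exists_eq_combo` and are determined by values on a
frame (`combo_coeff_unique`).

Lift. Since φ*θ = 0, also φ*dθ = 0, so the tangent planes of φ are null for |α¹|² + |α²|² − |α³|² −
|α⁴|² (`levi_null`). A null plane meets {α¹ = α² = 0} only in 0. It is therefore a graph (α³, α⁴) =
U(α¹, α²), and nullity makes U an isometry (`exists_unitary`). Solving this linear system for U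
gives the formula, uniqueness and smoothness.

Vanishing. Differentiating the graph equation along φ and multiplying by U* shows that the torsion
column pulls back to m ∧ (α¹, α²)ᵀ with m = U*dU (`torsionForm_eq`). Write m_kl = Σ_j (p_kl,j αʲ +
q_kl,j ᾱʲ), with indices 1, 2. Comparing coefficients gives B = −q_11,2, E = p_12,1 − p_11,2, F =
−q_21,1, and D = −q_12,2, J = p_22,1 − p_21,2, H = −q_22,1. As m is skew-Hermitian
(`star_maurerCartan`), the conjugate of q_kl,j is −p_lk,j, and T₁ and T₂ cancel term by term. -/

theorem IsDefiningFunctionOn.contDiffAt (hρ : IsDefiningFunctionOn M W ρ) (hz : z ∈ W)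
    (n : ℕ∞ω) : ContDiffAt ℝ n ρ z :=
  (hρ.analytic z hz).contDiffAt

/-- Lagrange multipliers: `f` is constant on the level set of `ρ` near `z`, so `z` is a constrained
extremum. Since dρ ≠ 0, the multiplier of df is nonzero and df is proportional to dρ. -/
theorem fderiv_real_apply_eq_zero_of_vanishing (hρ : IsDefiningFunctionOn M W ρ)
    (hz : z ∈ M ∩ W) {f : C5 → ℝ} (hf : ContDiffAt ℝ 1 f z) (h0 : ∀ x ∈ M ∩ W, f x = 0)
    {u : C5} (hu : fderiv ℝ ρ z u = 0) : fderiv ℝ f z u = 0 := by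
  have hρz : ρ z = 0 := (hρ.mem_iff z hz.2).1 hz.1
  have hloc : IsLocalExtrOn f {x | ρ x = ρ z} z := by
    refine Or.inl ?_
    have hW : ∀ᶠ x in nhdsWithin z {x | ρ x = ρ z}, x ∈ W :=
      nhdsWithin_le_nhds (hρ.isOpen.mem_nhds hz.2)
    filter_upwards [hW, self_mem_nhdsWithin] with x hxW hx
    have hxM : x ∈ M := (hρ.mem_iff x hxW).2 (by rw [← hρz]; exact hx)
    rw [h0 x ⟨hxM, hxW⟩, h0 z hz]
  obtain ⟨a, b, hab, h⟩ := hloc.exists_multipliers_of_hasStrictFDerivAt_1d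
    ((hρ.contDiffAt hz.2 1).hasStrictFDerivAt one_ne_zero)
    (hf.hasStrictFDerivAt one_ne_zero)
  have hb : b ≠ 0 := by
    rintro rfl
    have ha : a ≠ 0 := by
      rintro rfl
      exact hab rfl
    rw [zero_smul, add_zero] at h
    exact hρ.fderiv_ne z hz.2 hz.1 ((smul_eq_zero.1 h).resolve_left ha)
  have h' := congrArg (fun l => l u) h
  simpa [hu, hb] using h'

/-- The differential of a function that vanishes on a hypersurface kills its tangent spaces. -/
theorem fderiv_apply_eq_zero_of_vanishing (hρ : IsDefiningFunctionOn M W ρ)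
    (hz : z ∈ M ∩ W) {f : C5 → ℂ} (hf : ContDiffAt ℝ 1 f z) (h0 : ∀ x ∈ M ∩ W, f x = 0)
    {u : C5} (hu : fderiv ℝ ρ z u = 0) : fderiv ℝ f z u = 0 := by
  have hd := (hf.differentiableAt one_ne_zero).hasFDerivAt
  have hre := fderiv_real_apply_eq_zero_of_vanishing hρ hz
    (Complex.reCLM.contDiff.contDiffAt.comp z hf) (fun x hx => by simp [h0 x hx]) hu
  have him := fderiv_real_apply_eq_zero_of_vanishing hρ hz
    (Complex.imCLM.contDiff.contDiffAt.comp z hf) (fun x hx => by simp [h0 x hx]) hu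
  rw [(Complex.reCLM.hasFDerivAt.comp z hd).fderiv] at hre
  rw [(Complex.imCLM.hasFDerivAt.comp z hd).fderiv] at him
  exact Complex.ext (by simpa using hre) (by simpa using him)

/-! ### The `(1,0)`-part of the differential of the defining function -/

/-- The complex linear form `2 ∂ρ`. -/
noncomputable def del (ρ : C5 → ℝ) (z : C5) : C5 →ₗ[ℂ] ℂ :=
  Module.Dual.extendRCLike (𝕜 := ℂ) (fderiv ℝ ρ z : C5 →ₗ[ℝ] ℝ)

theorem del_apply (v : C5) :
    del ρ z v = fderiv ℝ ρ z v - Complex.I * fderiv ℝ ρ z (Complex.I • v) := by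
  simp [del, Module.Dual.extendRCLike_apply]

theorem mem_complexTangent_iff {v : C5} : v ∈ complexTangent ρ z ↔ del ρ z v = 0 := by
  rw [del_apply]
  constructor
  · rintro ⟨h, h'⟩
    simp [h, h']
  · intro h
    have h1 := congrArg Complex.re h
    have h2 := congrArg Complex.im h
    exact ⟨by simpa using h1, by simpa using h2⟩

theorem complexTangent_eq_ker : complexTangent ρ z = LinearMap.ker (del ρ z) := by
  ext v
  rw [mem_complexTangent_iff, LinearMap.mem_ker]

theorem del_ne_zero (h : fderiv ℝ ρ z ≠ 0) : del ρ z ≠ 0 := by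
  intro h0
  apply h
  ext v
  have h1 := congrArg Complex.re (congrArg (fun l => l v) h0)
  rw [del_apply] at h1
  simpa using h1

theorem finrank_complexTangent (h : fderiv ℝ ρ z ≠ 0) :
    Module.finrank ℂ (complexTangent ρ z) = 4 := by
  have h1 := Module.Dual.finrank_ker_add_one_of_ne_zero (del_ne_zero h)
  rw [complexTangent_eq_ker]
  have : Module.finrank ℂ C5 = 5 := by simp
  omega

theorem complexTangent_le_tangent {v : C5} (hv : v ∈ complexTangent ρ z) : v ∈ tangent ρ z :=
  hv.1

theorem theta_apply (v : C5) : theta ρ z v = Complex.I / 2 *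
    (fderiv ℝ ρ z v + Complex.I * fderiv ℝ ρ z (Complex.I • v)) := by
  simp [theta]
  ring

theorem theta_eq_zero_of_mem {v : C5} (hv : v ∈ complexTangent ρ z) : theta ρ z v = 0 := by
  rw [theta_apply, hv.1, hv.2]
  simp

/-! ### Integrability -/

variable {β : C5 → Cov}

/-- A one-form which is complex linear on the complex tangent spaces of a hypersurface has a
differential without `(0,2)`-part. -/
theorem dForm_integrable (hρ : IsDefiningFunctionOn M W ρ) (hz : z ∈ M ∩ W)
    (hβ : ContDiffAt ℝ 1 β z)
    (h10 : ∀ x ∈ M ∩ W, ∀ v ∈ complexTangent ρ x, β x (Complex.I • v) = Complex.I * β x v)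
    {v w : C5} (hv : v ∈ complexTangent ρ z) (hw : w ∈ complexTangent ρ z) :
    dForm β z v w - dForm β z (Complex.I • v) (Complex.I • w) +
      Complex.I * (dForm β z v (Complex.I • w) + dForm β z (Complex.I • v) w) = 0 := by
  -- With `n` transverse to T^c, a constant vector `w` can be corrected to the field `del ρ x n • w
  -- - del ρ x w • n`, which lies in T^c at every point and equals `w` at `z` when `w` is in T^c
  -- there.
  obtain ⟨n, hn⟩ : ∃ n, del ρ z n = 1 :=
    LinearMap.surjective (del_ne_zero (hρ.fderiv_ne z hz.2 hz.1)) 1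
  have hβd := hβ.differentiableAt one_ne_zero
  have hρ1 : ContDiffAt ℝ 1 (fderiv ℝ ρ) z :=
    (hρ.contDiffAt hz.2 2).fderiv_right (by norm_num)
  have hρd := hρ1.differentiableAt one_ne_zero
  set R := fderiv ℝ (fderiv ℝ ρ) z with hR
  have hsymm : ∀ a b, R a b = R b a :=
    (hρ.contDiffAt hz.2 2).isSymmSndFDerivAt (by simp)
  have hdelC : ∀ w, ContDiffAt ℝ 1 (fun x => del ρ x w) z := by
    intro w
    simp only [del_apply]
    have h1 : ∀ w, ContDiffAt ℝ 1 (fun x => (fderiv ℝ ρ x w : ℂ)) z := fun w =>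
      Complex.ofRealCLM.contDiff.contDiffAt.comp z (hρ1.clm_apply contDiffAt_const)
    exact (h1 w).sub (contDiffAt_const.mul (h1 _))
  have hdelD : ∀ w, HasFDerivAt (fun x => del ρ x w)
      (Complex.ofRealCLM.comp (R.flip w) -
        Complex.I • Complex.ofRealCLM.comp (R.flip (Complex.I • w))) z := by
    intro w
    simp only [del_apply]
    have h1 : ∀ w, HasFDerivAt (fun x => (fderiv ℝ ρ x w : ℂ))
        (Complex.ofRealCLM.comp (R.flip w)) z := fun w => by
      have h2 : HasFDerivAt (fun x => fderiv ℝ ρ x w) (R.flip w) z := by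
        simpa using hρd.hasFDerivAt.clm_apply (hasFDerivAt_const w z)
      exact Complex.ofRealCLM.hasFDerivAt.comp z h2
    exact (h1 w).sub ((h1 _).const_mul _)
  set h : C5 → C5 → ℂ := fun u w => R u w - Complex.I * R u (Complex.I • w) with hh
  -- Differentiate β(iX) = iβ(X) along `u` for the corrected field X. The multiples of `w` in the
  -- derivative of X cancel by complex linearity of β on T^c; the multiple `h u w` of `n` remains.
  have key : ∀ u w, fderiv ℝ ρ z u = 0 → w ∈ complexTangent ρ z →
      fderiv ℝ β z u (Complex.I • w) - Complex.I * fderiv ℝ β z u w =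
        β z ((Complex.I * h u w) • n) - Complex.I * β z (h u w • n) := by
    intro u w hu hw
    have hX : ∀ w, ContDiffAt ℝ 1 (fun x => β x (del ρ x n • w - del ρ x w • n)) z := fun w =>
      hβ.clm_apply (((hdelC n).smul contDiffAt_const).sub ((hdelC w).smul contDiffAt_const))
    have hXd : ∀ w, HasFDerivAt (fun x => β x (del ρ x n • w - del ρ x w • n)) _ z := fun w =>
      hβd.hasFDerivAt.clm_apply (((hdelD n).smul (hasFDerivAt_const w z)).sub
        ((hdelD w).smul (hasFDerivAt_const n z)))
    have hv := fderiv_apply_eq_zero_of_vanishing hρ hz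
      ((hX (Complex.I • w)).sub (contDiffAt_const.mul (hX w)) :
        ContDiffAt ℝ 1 (fun x => β x (del ρ x n • Complex.I • w - del ρ x (Complex.I • w) • n) -
          Complex.I * β x (del ρ x n • w - del ρ x w • n)) z)
      (by
        intro x hx
        have hmem : del ρ x n • w - del ρ x w • n ∈ complexTangent ρ x := by
          rw [mem_complexTangent_iff]
          simp [mul_comm]
        have := h10 x hx _ hmem
        rw [sub_eq_zero, ← this, smul_sub, smul_comm Complex.I (del ρ x n) w, map_smul,
          smul_eq_mul, mul_smul])
      hu
    have e := ((hXd (Complex.I • w)).sub ((hXd w).const_mul Complex.I)).fderiv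
    have hv' := (congrArg (fun l => l u) e).symm.trans hv
    have hw' : Complex.I • w ∈ complexTangent ρ z := Submodule.smul_mem _ _ hw
    have hw0 := mem_complexTangent_iff.1 hw
    have hw1 := mem_complexTangent_iff.1 hw'
    have hc : ∀ c : ℂ, β z (c • Complex.I • w) = Complex.I * β z (c • w) := fun c => by
      rw [smul_comm, h10 z hz _ (Submodule.smul_mem _ _ hw)]
    have hII : h u (Complex.I • w) = Complex.I * h u w := by
      simp only [hh, smul_smul, Complex.I_mul_I, neg_smul, one_smul, map_neg, Complex.ofReal_neg]
      linear_combination (R u (Complex.I • w) : ℂ) * Complex.I_mul_I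
    have hhn : ∀ w, (R u w : ℂ) - Complex.I * R u (Complex.I • w) = h u w := fun _ => rfl
    simp only [sub_apply, add_apply,
      ContinuousLinearMap.comp_apply, ContinuousLinearMap.flip_apply,
      smul_apply, ContinuousLinearMap.smulRight_apply,
      Complex.ofRealCLM_apply, hw0, hw1, hn, smul_zero, zero_add, zero_smul, sub_zero, one_smul,
      smul_eq_mul, hhn, hII, map_sub, hc] at hv'
    linear_combination hv'
  set k : ℂ := β z (Complex.I • n) - Complex.I * β z n with hk
  have hcn : ∀ c : ℂ, β z (c • n) = c.re * β z n + c.im * β z (Complex.I • n) := by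
    intro c
    have : c • n = c.re • n + c.im • (Complex.I • n) := by
      ext i
      simp only [Pi.add_apply, Pi.smul_apply, smul_eq_mul, Complex.real_smul]
      conv_lhs => rw [← Complex.re_add_im c]
      ring
    rw [this, map_add, map_smul, map_smul, Complex.real_smul, Complex.real_smul]
  -- The remaining defect is the conjugate of `h u w` times `k`, where `k` measures the failure of
  -- complex linearity of β on `n`.
  have key' : ∀ u w, fderiv ℝ ρ z u = 0 → w ∈ complexTangent ρ z →
      fderiv ℝ β z u (Complex.I • w) - Complex.I * fderiv ℝ β z u w =
        (R u w + Complex.I * R u (Complex.I • w)) * k := by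
    intro u w hu hw
    rw [key u w hu hw, hcn (Complex.I * h u w), hcn (h u w), hk]
    simp only [hh, Complex.mul_re, Complex.mul_im, Complex.sub_re, Complex.sub_im,
      Complex.ofReal_re, Complex.ofReal_im, Complex.I_re, Complex.I_im]
    push_cast
    linear_combination (R u (Complex.I • w) * β z n : ℂ) * Complex.I_mul_I
  have e1 := key' v w hv.1 hw
  have e2 := key' (Complex.I • v) w hv.2 hw
  have e3 := key' w v hw.1 hv
  have e4 := key' (Complex.I • w) v hw.2 hv
  -- Symmetry of the Hessian of ρ makes the `k`-terms cancel in the alternating combination.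
  rw [hsymm (Complex.I • v) w] at e2
  rw [hsymm w v] at e3
  rw [hsymm (Complex.I • w) v, hsymm (Complex.I • w) (Complex.I • v)] at e4
  simp only [dForm_apply hβd]
  linear_combination Complex.I * e1 - e2 - Complex.I * e3 + e4 +
    (fderiv ℝ β z v w - fderiv ℝ β z w v + k * (R v (Complex.I • w) - R w (Complex.I • v))) *
      Complex.I_mul_I

end Hypersurface

/-! ### Alternating two-forms -/

/-- A function of two vectors which is the alternation of a real bilinear map. -/
def IsTwoForm (Ψ : C5 → C5 → ℂ) : Prop :=
  ∃ B : C5 →L[ℝ] C5 →L[ℝ] ℂ, ∀ v w, Ψ v w = B v w - B w v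

namespace IsTwoForm

variable {Ψ Ψ' : C5 → C5 → ℂ}

theorem add (h : IsTwoForm Ψ) (h' : IsTwoForm Ψ') : IsTwoForm fun v w => Ψ v w + Ψ' v w := by
  obtain ⟨B, hB⟩ := h
  obtain ⟨B', hB'⟩ := h'
  refine ⟨B + B', fun v w => ?_⟩
  simp only [hB, hB', add_apply]
  ring

theorem const_mul (h : IsTwoForm Ψ) (c : ℂ) : IsTwoForm fun v w => c * Ψ v w := by
  obtain ⟨B, hB⟩ := h
  refine ⟨c • B, fun v w => ?_⟩
  simp only [hB, smul_apply, smul_eq_mul]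
  ring

theorem sub (h : IsTwoForm Ψ) (h' : IsTwoForm Ψ') : IsTwoForm fun v w => Ψ v w - Ψ' v w := by
  simpa [sub_eq_add_neg] using h.add (h'.const_mul (-1))

theorem wedge (a b : Cov) : IsTwoForm (wedge a b) := by
  refine ⟨a.smulRight b, fun v w => ?_⟩
  simp [CRBidisk.wedge]

theorem dForm {β : C5 → Cov} {z : C5} (h : DifferentiableAt ℝ β z) : IsTwoForm (dForm β z) :=
  ⟨fderiv ℝ β z, fun v w => dForm_apply h v w⟩

theorem combo (α : Fin 4 → C5 → Cov) (z : C5) (a b c d e : ℂ) :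
    IsTwoForm (combo α z a b c d e) :=
  (((((wedge _ _).const_mul a).add ((wedge _ _).const_mul b)).add
    ((wedge _ _).const_mul c)).add ((wedge _ _).const_mul d)).add ((wedge _ _).const_mul e)

theorem exists_bilin (h : IsTwoForm Ψ) : ∃ L : C5 →L[ℝ] C5 →L[ℝ] ℂ,
    (∀ v w, L v w = Ψ v w) ∧ ∀ v w, L v w = -L w v := by
  obtain ⟨B, hB⟩ := h
  refine ⟨B - B.flip, fun v w => ?_, fun v w => ?_⟩
  · rw [hB]
    simp
  · simp

end IsTwoForm

theorem torsionForm_isTwoForm {α : Fin 4 → C5 → Cov} {z : C5}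
    (h : ∀ i, DifferentiableAt ℝ (α i) z) (U : Matrix (Fin 2) (Fin 2) ℂ) (k : Fin 2) :
    IsTwoForm (torsionForm α z U k) := by
  refine (((IsTwoForm.dForm (h 2)).const_mul _).add ((IsTwoForm.dForm (h 3)).const_mul _)).sub
    (IsTwoForm.dForm ?_)
  fin_cases k
  · exact h 0
  · exact h 1

theorem smul_eq_re_add_im (c : ℂ) (v : C5) : c • v = c.re • v + c.im • (Complex.I • v) := by
  ext i
  simp only [Pi.add_apply, Pi.smul_apply, smul_eq_mul, Complex.real_smul]
  conv_lhs => rw [← Complex.re_add_im c]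
  ring

theorem conjCov_apply (a : Cov) (v : C5) : conjCov a v = star (a v) := rfl

/-! ### Frames dual to an adapted coframe -/

section Coframe

variable {M W : Set C5} {ρ : C5 → ℝ} {α : Fin 4 → C5 → Cov} {z : C5}

namespace IsAdaptedCoframe

theorem contDiffAt (hρ : IsDefiningFunctionOn M W ρ) (hα : IsAdaptedCoframe M W ρ α)
    (hz : z ∈ W) (i : Fin 4) : ContDiffAt ℝ ∞ (α i) z :=
  (hα.smooth i).contDiffAt (hρ.isOpen.mem_nhds hz)

theorem differentiableAt (hρ : IsDefiningFunctionOn M W ρ) (hα : IsAdaptedCoframe M W ρ α)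
    (hz : z ∈ W) (i : Fin 4) : DifferentiableAt ℝ (α i) z :=
  (contDiffAt hρ hα hz i).differentiableAt (by simp)

theorem map_smul (hα : IsAdaptedCoframe M W ρ α) (hz : z ∈ M ∩ W) (i : Fin 4) {v : C5}
    (hv : v ∈ complexTangent ρ z) (c : ℂ) : α i z (c • v) = c * α i z v := by
  rw [smul_eq_re_add_im, map_add, _root_.map_smul, _root_.map_smul, hα.type10 z hz i v hv,
    Complex.real_smul, Complex.real_smul]
  conv_rhs => rw [← Complex.re_add_im c]
  ring

theorem eq_of_forall_eq (hα : IsAdaptedCoframe M W ρ α) (hz : z ∈ M ∩ W) {v w : C5}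
    (hv : v ∈ complexTangent ρ z) (hw : w ∈ complexTangent ρ z)
    (h : ∀ i, α i z v = α i z w) : v = w :=
  sub_eq_zero.1 (hα.coframe z hz _ (Submodule.sub_mem _ hv hw) fun i => by simp [h])

/-- The coframe is an injective complex linear map from T^c to ℂ⁴, and both spaces have dimension 4.
-/
theorem exists_eq (hρ : IsDefiningFunctionOn M W ρ) (hα : IsAdaptedCoframe M W ρ α)
    (hz : z ∈ M ∩ W) (c : Fin 4 → ℂ) : ∃ v ∈ complexTangent ρ z, ∀ i, α i z v = c i := by
  let f : complexTangent ρ z →ₗ[ℂ] (Fin 4 → ℂ) :=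
    { toFun := fun v i => α i z v
      map_add' := fun v w => by
        ext i
        simp
      map_smul' := fun c v => by
        ext i
        simp [map_smul hα hz i v.2 c] }
  have hf : Function.Injective f := fun v w h =>
    Subtype.ext (eq_of_forall_eq hα hz v.2 w.2 fun i => congrFun h i)
  have hdim : Module.finrank ℂ (complexTangent ρ z) = Module.finrank ℂ (Fin 4 → ℂ) := by
    rw [finrank_complexTangent (hρ.fderiv_ne z hz.2 hz.1)]
    simp
  obtain ⟨v, hv⟩ := (LinearMap.injective_iff_surjective_of_finrank_eq_finrank hdim).1 hf c
  exact ⟨v, v.2, fun i => congrFun hv i⟩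

theorem exists_transversal (hρ : IsDefiningFunctionOn M W ρ) (hα : IsAdaptedCoframe M W ρ α)
    (hz : z ∈ M ∩ W) : ∃ n ∈ tangent ρ z, theta ρ z n = 1 ∧ ∀ i, α i z n = 0 := by
  -- The value 2i encodes dρ(n) = 0 and dρ(in) = −2, which gives θ(n) = 1.
  obtain ⟨n, hn⟩ : ∃ n, del ρ z n = 2 * Complex.I :=
    LinearMap.surjective (del_ne_zero (hρ.fderiv_ne z hz.2 hz.1)) _
  rw [del_apply] at hn
  have h1 : fderiv ℝ ρ z n = 0 := by simpa using congrArg Complex.re hn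
  have h2 : fderiv ℝ ρ z (Complex.I • n) = -2 := by
    have := congrArg Complex.im hn
    simp at this
    linarith
  obtain ⟨v, hv, hvn⟩ := exists_eq hρ hα hz fun i => α i z n
  refine ⟨n - v, ?_, ?_, fun i => by simp [hvn]⟩
  · exact Submodule.sub_mem _ h1 hv.1
  · rw [map_sub, theta_eq_zero_of_mem hv, theta_apply, h1, h2]
    push_cast
    linear_combination -Complex.I_mul_I

end IsAdaptedCoframe

theorem theta_eq_re {v : C5} (hv : v ∈ tangent ρ z) : theta ρ z v = (theta ρ z v).re := by
  have h : fderiv ℝ ρ z v = 0 := hv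
  have : theta ρ z v = ((-(1 / 2) * fderiv ℝ ρ z (Complex.I • v) : ℝ) : ℂ) := by
    rw [theta_apply, h]
    push_cast
    linear_combination (1 / 2 * fderiv ℝ ρ z (Complex.I • v) : ℂ) * Complex.I_mul_I
  rw [this, Complex.ofReal_re]

theorem mem_complexTangent_of_theta {v : C5} (hv : v ∈ tangent ρ z) (h : theta ρ z v = 0) :
    v ∈ complexTangent ρ z := by
  have h0 : fderiv ℝ ρ z v = 0 := hv
  refine ⟨h0, ?_⟩
  rw [theta_apply, h0] at h
  simpa using h

theorem omega3_apply (U : Matrix (Fin 2) (Fin 2) ℂ) (v : C5) :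
    omega3 α z U v = α 2 z v - U 0 0 * α 0 z v - U 0 1 * α 1 z v := by
  simp [omega3]

theorem omega4_apply (U : Matrix (Fin 2) (Fin 2) ℂ) (v : C5) :
    omega4 α z U v = α 3 z v - U 1 0 * α 0 z v - U 1 1 * α 1 z v := by
  simp [omega4]

/-- The vector `v` is annihilated by the generators of the ideal `𝓘`. -/
structure IsIntegralVector (ρ : C5 → ℝ) (α : Fin 4 → C5 → Cov) (z : C5)
    (U : Matrix (Fin 2) (Fin 2) ℂ) (v : C5) : Prop where
  mem : v ∈ complexTangent ρ z
  omega3 : omega3 α z U v = 0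
  omega4 : omega4 α z U v = 0

namespace IsIntegralVector

theorem exists_eq (hρ : IsDefiningFunctionOn M W ρ) (hα : IsAdaptedCoframe M W ρ α)
    (hz : z ∈ M ∩ W) (U : Matrix (Fin 2) (Fin 2) ℂ) (a b : ℂ) :
    ∃ v, IsIntegralVector ρ α z U v ∧ α 0 z v = a ∧ α 1 z v = b := by
  obtain ⟨v, hv, h⟩ := IsAdaptedCoframe.exists_eq hρ hα hz
    ![a, b, U 0 0 * a + U 0 1 * b, U 1 0 * a + U 1 1 * b]
  have h0 : α 0 z v = a := h 0
  have h1 : α 1 z v = b := h 1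
  have h2 : α 2 z v = U 0 0 * a + U 0 1 * b := h 2
  have h3 : α 3 z v = U 1 0 * a + U 1 1 * b := h 3
  refine ⟨v, ⟨hv, ?_, ?_⟩, h0, h1⟩
  · rw [omega3_apply, h0, h1, h2]
    ring
  · rw [omega4_apply, h0, h1, h3]
    ring

end IsIntegralVector

/-- Congruence of two-forms modulo `𝓘` is equality on the vectors annihilated by `𝓘`. -/
theorem congrMod_idealGens_iff (hρ : IsDefiningFunctionOn M W ρ)
    (hα : IsAdaptedCoframe M W ρ α) (hz : z ∈ M ∩ W) (U : Matrix (Fin 2) (Fin 2) ℂ)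
    {Ψ Ψ' : C5 → C5 → ℂ} (hΨ : IsTwoForm Ψ) (hΨ' : IsTwoForm Ψ') :
    CongrMod (tangent ρ z) (idealGens ρ α z U) Ψ Ψ' ↔
      ∀ v w, IsIntegralVector ρ α z U v → IsIntegralVector ρ α z U w → Ψ v w = Ψ' v w := by
  constructor
  · rintro ⟨η, hη⟩ v w hv hw
    have h0 : ∀ v, IsIntegralVector ρ α z U v → ∀ k, idealGens ρ α z U k v = 0 := by
      intro v hv k
      fin_cases k
      · exact theta_eq_zero_of_mem hv.mem
      · exact hv.omega3
      · exact hv.omega4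
      · show conjCov (omega3 α z U) v = 0
        rw [conjCov_apply, hv.omega3, star_zero]
      · show conjCov (omega4 α z U) v = 0
        rw [conjCov_apply, hv.omega4, star_zero]
    have h := hη v (complexTangent_le_tangent hv.mem) w (complexTangent_le_tangent hw.mem)
    rw [← sub_eq_zero, h]
    exact Finset.sum_eq_zero fun k _ => by simp [wedge, h0 v hv, h0 w hw]
  · intro h
    obtain ⟨L, hL, hLs⟩ := (hΨ.sub hΨ').exists_bilin
    obtain ⟨n, hnT, hn, hnα⟩ := IsAdaptedCoframe.exists_transversal hρ hα hz
    obtain ⟨f, hf, hfα⟩ := IsAdaptedCoframe.exists_eq hρ hα hz ![0, 0, 1, 0]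
    obtain ⟨g, hg, hgα⟩ := IsAdaptedCoframe.exists_eq hρ hα hz ![0, 0, 0, 1]
    set o3 := omega3 α z U with ho3
    set o4 := omega4 α z U with ho4
    set t := theta ρ z with ht
    -- On T_zM, `v - q v` is the projection onto the integral plane along `n` and the complex lines
    -- of `f`, `g`. The coefficient of `n` must be real to stay in T_zM, and θ is real there.
    let q : C5 →L[ℝ] C5 :=
      (Complex.reCLM.comp t).smulRight n + o3.smulRight f + o4.smulRight g
    have hq : ∀ v, q v = (t v).re • n + o3 v • f + o4 v • g := fun v => rfl
    have hp : ∀ v ∈ tangent ρ z, IsIntegralVector ρ α z U (v - q v) := by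
      intro v hv
      have htq : t (q v) = t v := by
        rw [hq, map_add, map_add, map_smul, hn,
          theta_eq_zero_of_mem (Submodule.smul_mem _ _ hf),
          theta_eq_zero_of_mem (Submodule.smul_mem _ _ hg)]
        rw [theta_eq_re hv]
        simp
      have hqT : q v ∈ tangent ρ z := Submodule.add_mem _ (Submodule.add_mem _
        (Submodule.smul_mem _ _ hnT) (complexTangent_le_tangent (Submodule.smul_mem _ _ hf)))
        (complexTangent_le_tangent (Submodule.smul_mem _ _ hg))
      have hαq : ∀ i, α i z (q v) = o3 v * α i z f + o4 v * α i z g := fun i => by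
        rw [hq, map_add, map_add, map_smul, hnα, hα.map_smul hz i hf, hα.map_smul hz i hg]
        simp
      refine ⟨mem_complexTangent_of_theta (Submodule.sub_mem _ hv hqT) ?_, ?_, ?_⟩
      · rw [map_sub, htq, sub_self]
      · have : o3 (q v) = o3 v := by
          rw [ho3, omega3_apply U (q v), hαq, hαq, hαq]
          simp [hfα, hgα, ho3, ho4]
        rw [map_sub, this, sub_self]
      · have : o4 (q v) = o4 v := by
          rw [ho4, omega4_apply U (q v), hαq, hαq, hαq]
          simp [hfα, hgα, ho3, ho4]
        rw [map_sub, this, sub_self]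
    -- The factor 1/2 shares the term L(qv, qw) equally: L(v − qv, w − qw) = 0 becomes L(v, w) =
    -- L(rv, qw) − L(rw, qv).
    let r : C5 →L[ℝ] C5 := ContinuousLinearMap.id ℝ C5 - (1 / 2 : ℝ) • q
    have hr : ∀ v, r v = v - (1 / 2 : ℝ) • q v := fun v => rfl
    let E : C5 → Cov := fun x => (L.flip x).comp r
    have hE : ∀ x v, E x v = L (r v) x := fun x v => rfl
    -- Read off from L(rv, qw): the real and imaginary parts of ω³, ω⁴ are rewritten through ω and
    -- ω̄.
    refine ⟨![E n, (1 / 2 : ℂ) • (E f - Complex.I • E (Complex.I • f)),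
      (1 / 2 : ℂ) • (E g - Complex.I • E (Complex.I • g)),
      (1 / 2 : ℂ) • (E f + Complex.I • E (Complex.I • f)),
      (1 / 2 : ℂ) • (E g + Complex.I • E (Complex.I • g))], fun v hv w hw => ?_⟩
    have h0 := h _ _ (hp v hv) (hp w hw)
    rw [← sub_eq_zero, ← hL] at h0
    have hS : ∀ x y, y ∈ tangent ρ z → L x (q y) = t y * L x n + (o3 y).re * L x f +
        (o3 y).im * L x (Complex.I • f) + (o4 y).re * L x g + (o4 y).im * L x (Complex.I • g) := by
      intro x y hy
      rw [hq, smul_eq_re_add_im (o3 y), smul_eq_re_add_im (o4 y), theta_eq_re hy]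
      simp only [map_add, map_smul, Complex.real_smul, Complex.ofReal_re]
      ring
    have e1 := hS (r v) w hw
    have e2 := hS (r w) v hv
    have e3 : L (r v) (q w) = L v (q w) - 1 / 2 * L (q v) (q w) := by
      rw [hr]
      simp
    have e4 : L (r w) (q v) = L w (q v) - 1 / 2 * L (q w) (q v) := by
      rw [hr]
      simp
    have e5 : L (v - q v) (w - q w) = L v w - L v (q w) - L (q v) w + L (q v) (q w) := by
      simp only [map_sub, sub_apply]
      ring
    have e6 := hLs (q w) (q v)
    have e7 := hLs w (q v)
    have hre : ∀ c : ℂ, (c.re : ℂ) = (c + star c) / 2 := fun c => by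
      rw [Complex.re_eq_add_conj]
      rfl
    have him : ∀ c : ℂ, (c.im : ℂ) = (star c - c) / 2 * Complex.I := fun c => by
      rw [Complex.im_eq_sub_conj]
      field_simp
      simp
    rw [hre, him, hre, him] at e1 e2
    rw [← hL]
    simp only [Fin.sum_univ_five, wedge, idealGens, Matrix.cons_val, conjCov_apply, smul_apply,
      add_apply, sub_apply, smul_eq_mul, hE, ← ho3, ← ho4, ← ht]
    linear_combination h0 - e5 + e1 - e2 - e3 + e4 + e7 - 1 / 2 * e6

end Coframe

/-! ### Existence and uniqueness of the torsion functions -/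

section Torsion

variable {M W : Set C5} {ρ : C5 → ℝ} {α : Fin 4 → C5 → Cov} {z : C5}
  {U : Matrix (Fin 2) (Fin 2) ℂ}

theorem combo_apply (a b c d e : ℂ) (v w : C5) : combo α z a b c d e v w =
    a * (α 0 z v * star (α 0 z w) - α 0 z w * star (α 0 z v)) +
    b * (α 0 z v * star (α 1 z w) - α 0 z w * star (α 1 z v)) +
    c * (α 1 z v * star (α 0 z w) - α 1 z w * star (α 0 z v)) +
    d * (α 1 z v * star (α 1 z w) - α 1 z w * star (α 1 z v)) +
    e * (α 0 z v * α 1 z w - α 0 z w * α 1 z v) := rfl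

/-- The hypothesis `h02` says that the (0,2)-part vanishes, so no ᾱ¹∧ᾱ² term is needed. -/
theorem exists_eq_combo (hρ : IsDefiningFunctionOn M W ρ) (hα : IsAdaptedCoframe M W ρ α)
    (hz : z ∈ M ∩ W) (U : Matrix (Fin 2) (Fin 2) ℂ) {Ψ : C5 → C5 → ℂ} (hΨ : IsTwoForm Ψ)
    (h02 : ∀ v ∈ complexTangent ρ z, ∀ w ∈ complexTangent ρ z,
      Ψ v w - Ψ (Complex.I • v) (Complex.I • w) +
        Complex.I * (Ψ v (Complex.I • w) + Ψ (Complex.I • v) w) = 0) :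
    ∃ a b c d e, ∀ v w, IsIntegralVector ρ α z U v → IsIntegralVector ρ α z U w →
      Ψ v w = combo α z a b c d e v w := by
  obtain ⟨L, hL, hLs⟩ := hΨ.exists_bilin
  simp only [← hL] at h02 ⊢
  obtain ⟨f, hf, hf0, hf1⟩ := IsIntegralVector.exists_eq hρ hα hz U 1 0
  obtain ⟨g, hg, hg0, hg1⟩ := IsIntegralVector.exists_eq hρ hα hz U 0 1
  set X := L f g with hX
  set Y := L f (Complex.I • g) with hY
  set Z := L (Complex.I • f) g with hZ
  have hV := h02 f hf.mem g hg.mem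
  rw [← hX, ← hY, ← hZ] at hV
  have hdecomp : ∀ v, IsIntegralVector ρ α z U v → v = (α 0 z v).re • f +
      (α 0 z v).im • (Complex.I • f) + (α 1 z v).re • g + (α 1 z v).im • (Complex.I • g) := by
    intro v hv
    rw [← smul_eq_re_add_im, add_assoc, ← smul_eq_re_add_im]
    refine hα.eq_of_forall_eq hz hv.mem (Submodule.add_mem _ (Submodule.smul_mem _ _ hf.mem)
      (Submodule.smul_mem _ _ hg.mem)) fun i => ?_
    have h3 := hv.omega3
    have h4 := hv.omega4
    have hf3 := hf.omega3
    have hf4 := hf.omega4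
    have hg3 := hg.omega3
    have hg4 := hg.omega4
    simp only [omega3_apply, omega4_apply, hf0, hf1, hg0, hg1] at h3 h4 hf3 hf4 hg3 hg4
    rw [map_add, hα.map_smul hz i hf.mem, hα.map_smul hz i hg.mem]
    fin_cases i
    · simp [hf0, hg0]
    · simp [hf1, hg1]
    · show α 2 z v = α 0 z v * α 2 z f + α 1 z v * α 2 z g
      linear_combination h3 - α 0 z v * hf3 - α 1 z v * hg3
    · show α 3 z v = α 0 z v * α 3 z f + α 1 z v * α 3 z g
      linear_combination h4 - α 0 z v * hf4 - α 1 z v * hg4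
  -- The solution of X = b − c + e, Y = i(−b − c + e), Z = i(b + c + e); on (f, if) and (g, ig) only
  -- a and d survive, with factor −2i.
  refine ⟨Complex.I / 2 * L f (Complex.I • f),
    (X + Complex.I / 2 * (Y + Z) + Complex.I / 2 * (Y - Z)) / 2,
    (Complex.I / 2 * (Y - Z) - X - Complex.I / 2 * (Y + Z)) / 2,
    Complex.I / 2 * L g (Complex.I • g), -(Complex.I / 2 * (Y + Z)), fun v w hv hw => ?_⟩
  have hff : L f f = 0 := by
    linear_combination 1 / 2 * hLs f f
  have hgg : L g g = 0 := by
    linear_combination 1 / 2 * hLs g g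
  have hff' : L (Complex.I • f) (Complex.I • f) = 0 := by
    linear_combination 1 / 2 * hLs (Complex.I • f) (Complex.I • f)
  have hgg' : L (Complex.I • g) (Complex.I • g) = 0 := by
    linear_combination 1 / 2 * hLs (Complex.I • g) (Complex.I • g)
  have e : L v w = L ((α 0 z v).re • f + (α 0 z v).im • (Complex.I • f) + (α 1 z v).re • g +
      (α 1 z v).im • (Complex.I • g)) ((α 0 z w).re • f +
      (α 0 z w).im • (Complex.I • f) + (α 1 z w).re • g + (α 1 z w).im • (Complex.I • g)) := by
    rw [← hdecomp v hv, ← hdecomp w hw]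
  have hV' : L (Complex.I • f) (Complex.I • g) = X + Complex.I * (Y + Z) := by
    linear_combination -hV
  rw [e, combo_apply]
  simp only [map_add, map_smul, add_apply, smul_apply, Complex.real_smul, hff, hgg, hff', hgg',
    hLs (Complex.I • f) f, hLs g f, hLs g (Complex.I • f), hLs (Complex.I • g) f,
    hLs (Complex.I • g) (Complex.I • f), hLs (Complex.I • g) g, hV', ← hX, ← hY, ← hZ]
  have hdec : ∀ c : ℂ, c = c.re + c.im * Complex.I := fun c => (Complex.re_add_im c).symm
  have hstar : ∀ c : ℂ, star c = c.re - c.im * Complex.I := fun c => by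
    apply Complex.ext <;> simp
  rw [hstar, hstar, hstar, hstar]
  generalize L f (Complex.I • f) = A
  generalize L g (Complex.I • g) = D
  generalize α 0 z v = v0 at *
  generalize α 1 z v = v1 at *
  generalize α 0 z w = w0 at *
  generalize α 1 z w = w1 at *
  rw [hdec v0, hdec v1, hdec w0, hdec w1]
  simp only [Complex.add_re, Complex.add_im, Complex.mul_re, Complex.mul_im, Complex.I_re,
    Complex.I_im, Complex.ofReal_re, Complex.ofReal_im, mul_zero, mul_one, sub_zero, add_zero,
    zero_add]
  have hI2 : Complex.I ^ 2 = -1 := Complex.I_sq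
  have hI3 : Complex.I ^ 3 = -Complex.I := by rw [pow_succ, hI2]; ring
  ring_nf
  simp only [hI2, hI3]
  ring

theorem combo_coeff_unique (hρ : IsDefiningFunctionOn M W ρ) (hα : IsAdaptedCoframe M W ρ α)
    (hz : z ∈ M ∩ W) {a b c d e a' b' c' d' e' : ℂ}
    (h : ∀ v w, IsIntegralVector ρ α z U v → IsIntegralVector ρ α z U w →
      combo α z a b c d e v w = combo α z a' b' c' d' e' v w) :
    a = a' ∧ b = b' ∧ c = c' ∧ d = d' ∧ e = e' := by
  obtain ⟨f, hf, hf0, hf1⟩ := IsIntegralVector.exists_eq hρ hα hz U 1 0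
  obtain ⟨f', hf', hf0', hf1'⟩ := IsIntegralVector.exists_eq hρ hα hz U Complex.I 0
  obtain ⟨g, hg, hg0, hg1⟩ := IsIntegralVector.exists_eq hρ hα hz U 0 1
  obtain ⟨g', hg', hg0', hg1'⟩ := IsIntegralVector.exists_eq hρ hα hz U 0 Complex.I
  have hI := Complex.I_mul_I
  have h1 := h f f' hf hf'
  have h2 := h g g' hg hg'
  have h3 := h f g hf hg
  have h4 := h f g' hf hg'
  have h5 := h f' g hf' hg
  simp only [combo_apply, hf0, hf1, hf0', hf1', hg0, hg1, hg0', hg1', star_zero, star_one,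
    Complex.star_def, Complex.conj_I] at h1 h2 h3 h4 h5
  have h4' : -b - c + e = -b' - c' + e' := by
    linear_combination -Complex.I * h4 + (e - e' - b + b' - c + c') * hI
  have h5' : b + c + e = b' + c' + e' := by
    linear_combination -Complex.I * h5 + (b - b' + c - c' + e - e') * hI
  refine ⟨?_, ?_, ?_, ?_, ?_⟩
  · linear_combination Complex.I / 2 * h1 + (a - a') * hI
  · linear_combination (h3 - h4') / 2
  · linear_combination (h5' - h3) / 2
  · linear_combination Complex.I / 2 * h2 + (d - d') * hI
  · linear_combination (h4' + h5') / 2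

/-- The torsion functions exist. -/
theorem exists_isTorsion (hρ : IsDefiningFunctionOn M W ρ) (hα : IsAdaptedCoframe M W ρ α) :
    ∃ t, IsTorsion M W ρ α t := by
  have key : ∀ z U, ∃ t : Torsion, z ∈ M ∩ W →
      CongrMod (tangent ρ z) (idealGens ρ α z U) (torsionForm α z U 0)
        (combo α z t.A t.B t.C t.D t.E) ∧
      CongrMod (tangent ρ z) (idealGens ρ α z U) (torsionForm α z U 1)
        (combo α z t.F t.G t.H t.I t.J) := by
    intro z U
    by_cases hz : z ∈ M ∩ W
    · have hd := fun i => IsAdaptedCoframe.differentiableAt hρ hα hz.2 i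
      have hint : ∀ i, ∀ v ∈ complexTangent ρ z, ∀ w ∈ complexTangent ρ z, _ :=
        fun i v hv w hw => dForm_integrable hρ hz
          ((IsAdaptedCoframe.contDiffAt hρ hα hz.2 i).of_le (by simp))
          (fun x hx => hα.type10 x hx i) hv hw
      have h : ∀ k, ∃ a b c d e,
          CongrMod (tangent ρ z) (idealGens ρ α z U) (torsionForm α z U k)
            (combo α z a b c d e) := by
        intro k
        obtain ⟨a, b, c, d, e, h⟩ := exists_eq_combo hρ hα hz U (torsionForm_isTwoForm hd U k)
          (by
            intro v hv w hw
            have h2 := hint 2 v hv w hw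
            have h3 := hint 3 v hv w hw
            have hk : dForm (![α 0, α 1] k) z v w -
                dForm (![α 0, α 1] k) z (Complex.I • v) (Complex.I • w) +
                Complex.I * (dForm (![α 0, α 1] k) z v (Complex.I • w) +
                  dForm (![α 0, α 1] k) z (Complex.I • v) w) = 0 := by
              fin_cases k
              · exact hint 0 v hv w hw
              · exact hint 1 v hv w hw
            unfold torsionForm
            linear_combination star U k 0 * h2 + star U k 1 * h3 - hk)
        exact ⟨a, b, c, d, e, (congrMod_idealGens_iff hρ hα hz U
          (torsionForm_isTwoForm hd U k) (IsTwoForm.combo α z a b c d e)).2 h⟩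
      obtain ⟨a, b, c, d, e, h0⟩ := h 0
      obtain ⟨a', b', c', d', e', h1⟩ := h 1
      exact ⟨⟨a, b, c, d, e, a', b', c', d', e'⟩, fun _ => ⟨h0, h1⟩⟩
    -- Arbitrary value off M ∩ W, where nothing is required.
    · exact ⟨⟨0, 0, 0, 0, 0, 0, 0, 0, 0, 0⟩, fun h => absurd h hz⟩
  choose t ht using key
  exact ⟨t, fun z hz U _ => ht z U hz⟩

theorem IsTorsion.eq_combo (hρ : IsDefiningFunctionOn M W ρ) (hα : IsAdaptedCoframe M W ρ α)
    {t : C5 → Matrix (Fin 2) (Fin 2) ℂ → Torsion} (ht : IsTorsion M W ρ α t)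
    (hz : z ∈ M ∩ W) (hU : U ∈ Matrix.unitaryGroup (Fin 2) ℂ) {v w : C5}
    (hv : IsIntegralVector ρ α z U v) (hw : IsIntegralVector ρ α z U w) :
    torsionForm α z U 0 v w =
      combo α z (t z U).A (t z U).B (t z U).C (t z U).D (t z U).E v w ∧
    torsionForm α z U 1 v w =
      combo α z (t z U).F (t z U).G (t z U).H (t z U).I (t z U).J v w := by
  have hd := fun i => IsAdaptedCoframe.differentiableAt hρ hα hz.2 i
  obtain ⟨h0, h1⟩ := ht z hz U hU
  exact ⟨(congrMod_idealGens_iff hρ hα hz U (torsionForm_isTwoForm hd U 0)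
      (IsTwoForm.combo _ _ _ _ _ _ _)).1 h0 v w hv hw,
    (congrMod_idealGens_iff hρ hα hz U (torsionForm_isTwoForm hd U 1)
      (IsTwoForm.combo _ _ _ _ _ _ _)).1 h1 v w hv hw⟩

/-- The torsion functions are unique. -/
theorem IsTorsion.unique (hρ : IsDefiningFunctionOn M W ρ) (hα : IsAdaptedCoframe M W ρ α)
    {t t' : C5 → Matrix (Fin 2) (Fin 2) ℂ → Torsion} (ht : IsTorsion M W ρ α t)
    (ht' : IsTorsion M W ρ α t') (hz : z ∈ M ∩ W) (hU : U ∈ Matrix.unitaryGroup (Fin 2) ℂ) :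
    t z U = t' z U := by
  obtain ⟨hA, hB, hC, hD, hE⟩ := combo_coeff_unique (U := U) hρ hα hz fun v w hv hw =>
    (ht.eq_combo hρ hα hz hU hv hw).1.symm.trans (ht'.eq_combo hρ hα hz hU hv hw).1
  obtain ⟨hF, hG, hH, hI, hJ⟩ := combo_coeff_unique (U := U) hρ hα hz fun v w hv hw =>
    (ht.eq_combo hρ hα hz hU hv hw).2.symm.trans (ht'.eq_combo hρ hα hz hU hv hw).2
  cases h : t z U
  cases h' : t' z U
  simp only [h, h'] at hA hB hC hD hE hF hG hH hI hJ
  subst hA hB hC hD hE hF hG hH hI hJ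
  rfl

end Torsion

/-! ### Pull-back of one-forms -/

theorem hasFDerivAt_pullback {E : Type*} [NormedAddCommGroup E] [NormedSpace ℝ E]
    {β : C5 → Cov} {φ : E → C5} {y : E} (hβ : DifferentiableAt ℝ β (φ y))
    (hφ : ContDiffAt ℝ 2 φ y) (v : E) :
    HasFDerivAt (fun x => β (φ x) (fderiv ℝ φ x v))
      ((β (φ y)).comp ((fderiv ℝ (fderiv ℝ φ) y).flip v) +
        ((fderiv ℝ β (φ y)).comp (fderiv ℝ φ y)).flip (fderiv ℝ φ y v)) y := by
  have h1 : HasFDerivAt φ (fderiv ℝ φ y) y :=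
    (hφ.differentiableAt (by norm_num)).hasFDerivAt
  have h2 : HasFDerivAt (fderiv ℝ φ) (fderiv ℝ (fderiv ℝ φ) y) y :=
    ((hφ.fderiv_right (m := 1) (by norm_num)).differentiableAt (by norm_num)).hasFDerivAt
  have h3 : HasFDerivAt (fun x => fderiv ℝ φ x v) ((fderiv ℝ (fderiv ℝ φ) y).flip v) y := by
    simpa using h2.clm_apply (hasFDerivAt_const v y)
  exact (hβ.hasFDerivAt.comp y h1).clm_apply h3

/-- The exterior derivative commutes with pull-backs. -/
theorem dForm_pullback {E : Type*} [NormedAddCommGroup E] [NormedSpace ℝ E]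
    {β : C5 → Cov} {φ : E → C5} {y : E} (hβ : DifferentiableAt ℝ β (φ y))
    (hφ : ContDiffAt ℝ 2 φ y) (u v : E) :
    dForm β (φ y) (fderiv ℝ φ y u) (fderiv ℝ φ y v) =
      fderiv ℝ (fun x => β (φ x) (fderiv ℝ φ x v)) y u -
        fderiv ℝ (fun x => β (φ x) (fderiv ℝ φ x u)) y v := by
  -- The terms β(D²φ(u, v)) cancel by this symmetry.
  have hs : fderiv ℝ (fderiv ℝ φ) y u v = fderiv ℝ (fderiv ℝ φ) y v u :=
    hφ.isSymmSndFDerivAt (by simp) u v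
  rw [(hasFDerivAt_pullback hβ hφ v).fderiv, (hasFDerivAt_pullback hβ hφ u).fderiv,
    dForm_apply hβ]
  simp [hs]

theorem differentiableAt_theta {ρ : C5 → ℝ} {z : C5} (h : ContDiffAt ℝ 2 ρ z) :
    DifferentiableAt ℝ (theta ρ) z := by
  have h1 : DifferentiableAt ℝ (fderiv ℝ ρ) z :=
    (h.fderiv_right (m := 1) (by norm_num)).differentiableAt (by norm_num)
  unfold theta
  fun_prop

theorem isOpen_bidisk : IsOpen bidisk :=
  (isOpen_lt continuous_fst.norm continuous_const).inter
    (isOpen_lt continuous_snd.norm continuous_const)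

/-! ### The lift of a holomorphic immersion -/

section Lift

variable {M W : Set C5} {ρ : C5 → ℝ} {α : Fin 4 → C5 → Cov} {φ : ℂ × ℂ → C5} {y : ℂ × ℂ}

namespace IsHolomorphicImmersion

theorem contDiffAt (hφ : IsHolomorphicImmersion M φ) (hy : y ∈ bidisk) : ContDiffAt ℝ ∞ φ y :=
  hφ.smooth.contDiffAt (isOpen_bidisk.mem_nhds hy)

theorem isOpen_domain (hρ : IsDefiningFunctionOn M W ρ) (hφ : IsHolomorphicImmersion M φ) :
    IsOpen (bidisk ∩ φ ⁻¹' W) :=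
  hφ.smooth.continuousOn.isOpen_inter_preimage isOpen_bidisk hρ.isOpen

theorem mem_inter (hφ : IsHolomorphicImmersion M φ) (hy : y ∈ bidisk ∩ φ ⁻¹' W) :
    φ y ∈ M ∩ W :=
  ⟨hφ.mapsTo hy.1, hy.2⟩

theorem mem_complexTangent (hρ : IsDefiningFunctionOn M W ρ) (hφ : IsHolomorphicImmersion M φ)
    (hy : y ∈ bidisk ∩ φ ⁻¹' W) (v : ℂ × ℂ) : fderiv ℝ φ y v ∈ complexTangent ρ (φ y) :=
  hφ.tangent y hy.1 W ρ hy.2 hρ v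

/-- Invariance of the image plane replaces complex linearity of dφ; the preimage `w` need not be `c
• v`. -/
theorem exists_smul (hφ : IsHolomorphicImmersion M φ) (hy : y ∈ bidisk) (c : ℂ) (v : ℂ × ℂ) :
    ∃ w, fderiv ℝ φ y w = c • fderiv ℝ φ y v := by
  obtain ⟨w, hw⟩ := hφ.invariant y hy v
  refine ⟨c.re • v + c.im • w, ?_⟩
  rw [map_add, map_smul, map_smul, hw, smul_eq_re_add_im c]

theorem exists_smul_add_smul (hφ : IsHolomorphicImmersion M φ) (hy : y ∈ bidisk) (a b : ℂ)
    (v w : ℂ × ℂ) : ∃ x, fderiv ℝ φ y x = a • fderiv ℝ φ y v + b • fderiv ℝ φ y w := by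
  obtain ⟨v', hv⟩ := hφ.exists_smul hy a v
  obtain ⟨w', hw⟩ := hφ.exists_smul hy b w
  exact ⟨v' + w', by rw [map_add, hv, hw]⟩

theorem dForm_theta_eq_zero (hρ : IsDefiningFunctionOn M W ρ)
    (hφ : IsHolomorphicImmersion M φ) (hy : y ∈ bidisk ∩ φ ⁻¹' W) (v w : ℂ × ℂ) :
    dForm (theta ρ) (φ y) (fderiv ℝ φ y v) (fderiv ℝ φ y w) = 0 := by
  have h0 : ∀ w, (fun x => theta ρ (φ x) (fderiv ℝ φ x w)) =ᶠ[nhds y] fun _ => 0 := by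
    intro w
    filter_upwards [(isOpen_domain hρ hφ).mem_nhds hy] with x hx
    exact theta_eq_zero_of_mem (mem_complexTangent hρ hφ hx w)
  rw [dForm_pullback (differentiableAt_theta (hρ.contDiffAt hy.2 2))
    ((hφ.contDiffAt hy.1).of_le (by norm_cast)), (h0 v).fderiv_eq, (h0 w).fderiv_eq]
  simp

/-- The tangent planes of a holomorphic immersion are null for the Levi form. -/
theorem levi_null (hρ : IsDefiningFunctionOn M W ρ) (hα : IsAdaptedCoframe M W ρ α)
    (hφ : IsHolomorphicImmersion M φ) (hy : y ∈ bidisk ∩ φ ⁻¹' W) (v w : ℂ × ℂ) :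
    α 0 (φ y) (fderiv ℝ φ y v) * star (α 0 (φ y) (fderiv ℝ φ y w)) +
      α 1 (φ y) (fderiv ℝ φ y v) * star (α 1 (φ y) (fderiv ℝ φ y w)) =
    α 2 (φ y) (fderiv ℝ φ y v) * star (α 2 (φ y) (fderiv ℝ φ y w)) +
      α 3 (φ y) (fderiv ℝ φ y v) * star (α 3 (φ y) (fderiv ℝ φ y w)) := by
  have hz := hφ.mem_inter hy
  obtain ⟨η, hη⟩ := hα.levi _ hz
  have hT := fun v => mem_complexTangent hρ hφ hy v
  have key : ∀ v w : ℂ × ℂ, _ := fun v w =>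
    hη _ (complexTangent_le_tangent (hT v)) _ (complexTangent_le_tangent (hT w))
  simp only [dForm_theta_eq_zero hρ hφ hy, wedge, conjCov_apply, Fin.sum_univ_one,
    Matrix.cons_val_fin_one, theta_eq_zero_of_mem (hT _), mul_zero, sub_zero, zero_sub,
    neg_eq_zero, mul_eq_zero, Complex.I_ne_zero, false_or] at key
  -- For the Hermitian form S, `key` gives S(v, w) − S(w, v) = 0. Replacing w by iw gives S(v, w) +
  -- S(w, v) = 0, hence S = 0.
  obtain ⟨w', hw'⟩ := hφ.invariant y hy.1 w
  have h1 := key v w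
  have h2 := key v w'
  rw [hw'] at h2
  have hI : star Complex.I = -Complex.I := Complex.conj_I
  simp only [hα.type10 _ hz _ _ (hT w), star_mul', hI] at h2
  generalize fderiv ℝ φ y v = a at *
  generalize fderiv ℝ φ y w = b at *
  linear_combination h1 / 2 + Complex.I / 2 * h2 +
    (α 0 (φ y) a * star (α 0 (φ y) b) + α 1 (φ y) a * star (α 1 (φ y) b) -
      α 2 (φ y) a * star (α 2 (φ y) b) - α 3 (φ y) a * star (α 3 (φ y) b) +
      α 0 (φ y) b * star (α 0 (φ y) a) + α 1 (φ y) b * star (α 1 (φ y) a) -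
      α 2 (φ y) b * star (α 2 (φ y) a) - α 3 (φ y) b * star (α 3 (φ y) a)) / 2 *
      Complex.I_mul_I

/-- Nullity turns α¹ = α² = 0 into |α³|² + |α⁴|² = 0, so the whole coframe vanishes on the image
vector. -/
theorem eq_zero_of_upper_eq_zero (hρ : IsDefiningFunctionOn M W ρ)
    (hα : IsAdaptedCoframe M W ρ α) (hφ : IsHolomorphicImmersion M φ)
    (hy : y ∈ bidisk ∩ φ ⁻¹' W) {v : ℂ × ℂ} (h0 : α 0 (φ y) (fderiv ℝ φ y v) = 0)
    (h1 : α 1 (φ y) (fderiv ℝ φ y v) = 0) : v = 0 := by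
  have h := levi_null hρ hα hφ hy v v
  rw [h0, h1] at h
  simp only [zero_mul, add_zero, Complex.star_def, Complex.mul_conj, ← Complex.ofReal_add] at h
  have h' := Complex.ofReal_eq_zero.1 h.symm
  have h2 : α 2 (φ y) (fderiv ℝ φ y v) = 0 := Complex.normSq_eq_zero.1 (by
    linarith [Complex.normSq_nonneg (α 2 (φ y) (fderiv ℝ φ y v)),
      Complex.normSq_nonneg (α 3 (φ y) (fderiv ℝ φ y v))])
  have h3 : α 3 (φ y) (fderiv ℝ φ y v) = 0 := Complex.normSq_eq_zero.1 (by
    linarith [Complex.normSq_nonneg (α 2 (φ y) (fderiv ℝ φ y v)),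
      Complex.normSq_nonneg (α 3 (φ y) (fderiv ℝ φ y v))])
  have hv : fderiv ℝ φ y v = 0 :=
    hα.coframe _ (hφ.mem_inter hy) _ (mem_complexTangent hρ hφ hy v) fun i => by
      fin_cases i
      exacts [h0, h1, h2, h3]
  exact hφ.immersive y hy.1 (by rw [hv, map_zero])

theorem exists_upper_eq (hρ : IsDefiningFunctionOn M W ρ) (hα : IsAdaptedCoframe M W ρ α)
    (hφ : IsHolomorphicImmersion M φ) (hy : y ∈ bidisk ∩ φ ⁻¹' W) (a b : ℂ) :
    ∃ v, α 0 (φ y) (fderiv ℝ φ y v) = a ∧ α 1 (φ y) (fderiv ℝ φ y v) = b := by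
  let L : ℂ × ℂ →ₗ[ℝ] ℂ × ℂ :=
    ((((α 0 (φ y)).comp (fderiv ℝ φ y)).prod ((α 1 (φ y)).comp (fderiv ℝ φ y)) :
      ℂ × ℂ →L[ℝ] ℂ × ℂ) : ℂ × ℂ →ₗ[ℝ] ℂ × ℂ)
  have hL : Function.Injective L := by
    rw [injective_iff_map_eq_zero]
    intro v hv
    exact eq_zero_of_upper_eq_zero hρ hα hφ hy (congrArg Prod.fst hv) (congrArg Prod.snd hv)
  obtain ⟨v, hv⟩ := LinearMap.injective_iff_surjective.1 hL (a, b)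
  exact ⟨v, congrArg Prod.fst hv, congrArg Prod.snd hv⟩

theorem exists_unitary (hρ : IsDefiningFunctionOn M W ρ) (hα : IsAdaptedCoframe M W ρ α)
    (hφ : IsHolomorphicImmersion M φ) (hy : y ∈ bidisk ∩ φ ⁻¹' W) :
    ∃ U ∈ Matrix.unitaryGroup (Fin 2) ℂ, ∀ v,
      omega3 α (φ y) U (fderiv ℝ φ y v) = 0 ∧ omega4 α (φ y) U (fderiv ℝ φ y v) = 0 := by
  have hz := hφ.mem_inter hy
  -- For the frame dual to α¹, α² the upper matrix is the identity, so U is the lower matrix;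
  -- nullity says that its columns are orthonormal.
  obtain ⟨f, hf0, hf1⟩ := exists_upper_eq hρ hα hφ hy 1 0
  obtain ⟨g, hg0, hg1⟩ := exists_upper_eq hρ hα hφ hy 0 1
  refine ⟨lowerMatrix α (φ y) (fderiv ℝ φ y f) (fderiv ℝ φ y g), ?_, fun v => ?_⟩
  · have hff := levi_null hρ hα hφ hy f f
    have hfg := levi_null hρ hα hφ hy f g
    have hgf := levi_null hρ hα hφ hy g f
    have hgg := levi_null hρ hα hφ hy g g
    simp only [hf0, hf1, hg0, hg1, star_one, star_zero, mul_one, mul_zero, add_zero,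
      zero_add] at hff hfg hgf hgg
    rw [Matrix.mem_unitaryGroup_iff']
    ext i j
    fin_cases i <;> fin_cases j <;>
      simp only [lowerMatrix, Matrix.mul_apply, Matrix.star_apply, Fin.sum_univ_two,
        Matrix.of_apply, Matrix.cons_val', Matrix.cons_val_zero, Matrix.cons_val_one,
        Matrix.cons_val_fin_one, Fin.zero_eta, Fin.mk_one, Fin.isValue, Matrix.one_apply_eq,
        ne_eq, one_ne_zero, zero_ne_one, not_false_eq_true, Matrix.one_apply_ne]
    · linear_combination -hff
    · linear_combination -hgf
    · linear_combination -hfg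
    · linear_combination -hgg
  · obtain ⟨w, hw⟩ := hφ.exists_smul_add_smul hy.1 (α 0 (φ y) (fderiv ℝ φ y v))
      (α 1 (φ y) (fderiv ℝ φ y v)) f g
    have hαw : ∀ i, α i (φ y) (fderiv ℝ φ y w) =
        α 0 (φ y) (fderiv ℝ φ y v) * α i (φ y) (fderiv ℝ φ y f) +
        α 1 (φ y) (fderiv ℝ φ y v) * α i (φ y) (fderiv ℝ φ y g) := fun i => by
      rw [hw, map_add, hα.map_smul hz i (mem_complexTangent hρ hφ hy f),
        hα.map_smul hz i (mem_complexTangent hρ hφ hy g)]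
    have hvw : v = w := by
      rw [← sub_eq_zero]
      refine eq_zero_of_upper_eq_zero hρ hα hφ hy ?_ ?_
      · rw [map_sub, map_sub, hαw, hf0, hg0]
        ring
      · rw [map_sub, map_sub, hαw, hf1, hg1]
        ring
    rw [← hvw] at hαw
    rw [omega3_apply, omega4_apply, hαw 2, hαw 3]
    simp only [lowerMatrix, Matrix.of_apply, Matrix.cons_val', Matrix.cons_val_zero,
      Matrix.cons_val_one, Matrix.cons_val_fin_one]
    constructor <;> ring

theorem exists_isLift (hρ : IsDefiningFunctionOn M W ρ) (hα : IsAdaptedCoframe M W ρ α)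
    (hφ : IsHolomorphicImmersion M φ) : ∃ U, IsLift W α φ U := by
  have h : ∀ y, ∃ U : Matrix (Fin 2) (Fin 2) ℂ, y ∈ bidisk ∩ φ ⁻¹' W →
      U ∈ Matrix.unitaryGroup (Fin 2) ℂ ∧ ∀ v,
      omega3 α (φ y) U (fderiv ℝ φ y v) = 0 ∧ omega4 α (φ y) U (fderiv ℝ φ y v) = 0 := by
    intro y
    by_cases hy : y ∈ bidisk ∩ φ ⁻¹' W
    · obtain ⟨U, hU, h⟩ := exists_unitary hρ hα hφ hy
      exact ⟨U, fun _ => ⟨hU, h⟩⟩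
    · exact ⟨0, fun h => absurd h hy⟩
  choose U hU using h
  exact ⟨U, hU⟩

/-- A relation between the columns comes from a tangent vector with α¹ = α² = 0, which is zero. -/
theorem isUnit_det_upperMatrix (hρ : IsDefiningFunctionOn M W ρ)
    (hα : IsAdaptedCoframe M W ρ α) (hφ : IsHolomorphicImmersion M φ)
    (hy : y ∈ bidisk ∩ φ ⁻¹' W) {v w : ℂ × ℂ}
    (h : LinearIndependent ℂ ![fderiv ℝ φ y v, fderiv ℝ φ y w]) :
    IsUnit (upperMatrix α (φ y) (fderiv ℝ φ y v) (fderiv ℝ φ y w)).det := by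
  rw [isUnit_iff_ne_zero, upperMatrix, Matrix.det_fin_two_of]
  intro hdet
  rw [LinearIndependent.pair_iff] at h
  have hz := hφ.mem_inter hy
  have key : ∀ a b : ℂ,
      a * α 0 (φ y) (fderiv ℝ φ y v) + b * α 0 (φ y) (fderiv ℝ φ y w) = 0 →
      a * α 1 (φ y) (fderiv ℝ φ y v) + b * α 1 (φ y) (fderiv ℝ φ y w) = 0 →
      a = 0 ∧ b = 0 := by
    intro a b h0 h1
    obtain ⟨x, hx⟩ := hφ.exists_smul_add_smul hy.1 a b v w
    have hαx : ∀ i, α i (φ y) (fderiv ℝ φ y x) =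
        a * α i (φ y) (fderiv ℝ φ y v) + b * α i (φ y) (fderiv ℝ φ y w) := fun i => by
      rw [hx, map_add, hα.map_smul hz i (mem_complexTangent hρ hφ hy v),
        hα.map_smul hz i (mem_complexTangent hρ hφ hy w)]
    have hx0 := eq_zero_of_upper_eq_zero hρ hα hφ hy ((hαx 0).trans h0) ((hαx 1).trans h1)
    exact h a b (by rw [← hx, hx0, map_zero])
  -- If the determinant is 0, each row gives a relation between the columns, so all entries vanish;
  -- then (1, 0) is a forbidden relation.
  obtain ⟨h1w, h1v⟩ := key (α 1 (φ y) (fderiv ℝ φ y w)) (-α 1 (φ y) (fderiv ℝ φ y v))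
    (by linear_combination hdet) (by ring)
  obtain ⟨h0w, h0v⟩ := key (α 0 (φ y) (fderiv ℝ φ y w)) (-α 0 (φ y) (fderiv ℝ φ y v))
    (by ring) (by linear_combination -hdet)
  have := (key 1 0 (by simpa using h0v) (by simpa using h1v)).1
  exact one_ne_zero this

end IsHolomorphicImmersion

/-! ### Formula, uniqueness and smoothness of the lift -/

namespace IsLift

open IsHolomorphicImmersion

variable {U U' : ℂ × ℂ → Matrix (Fin 2) (Fin 2) ℂ}

theorem lower_apply (hU : IsLift W α φ U) (hy : y ∈ bidisk ∩ φ ⁻¹' W) (v : ℂ × ℂ) :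
    α 2 (φ y) (fderiv ℝ φ y v) = U y 0 0 * α 0 (φ y) (fderiv ℝ φ y v) +
      U y 0 1 * α 1 (φ y) (fderiv ℝ φ y v) ∧
    α 3 (φ y) (fderiv ℝ φ y v) = U y 1 0 * α 0 (φ y) (fderiv ℝ φ y v) +
      U y 1 1 * α 1 (φ y) (fderiv ℝ φ y v) := by
  obtain ⟨h3, h4⟩ := (hU y hy).2 v
  rw [omega3_apply] at h3
  rw [omega4_apply] at h4
  exact ⟨by linear_combination h3, by linear_combination h4⟩

theorem mul_upperMatrix (hU : IsLift W α φ U) (hy : y ∈ bidisk ∩ φ ⁻¹' W) (v w : ℂ × ℂ) :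
    U y * upperMatrix α (φ y) (fderiv ℝ φ y v) (fderiv ℝ φ y w) =
      lowerMatrix α (φ y) (fderiv ℝ φ y v) (fderiv ℝ φ y w) := by
  obtain ⟨hv3, hv4⟩ := hU.lower_apply hy v
  obtain ⟨hw3, hw4⟩ := hU.lower_apply hy w
  ext i j
  fin_cases i <;> fin_cases j <;>
    simp [upperMatrix, lowerMatrix, Matrix.mul_apply, Fin.sum_univ_two, hv3, hv4, hw3, hw4]

theorem eq_lower_mul_upper_inv (hU : IsLift W α φ U) (hy : y ∈ bidisk ∩ φ ⁻¹' W)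
    {v w : ℂ × ℂ}
    (h : IsUnit (upperMatrix α (φ y) (fderiv ℝ φ y v) (fderiv ℝ φ y w)).det) :
    U y = lowerMatrix α (φ y) (fderiv ℝ φ y v) (fderiv ℝ φ y w) *
      (upperMatrix α (φ y) (fderiv ℝ φ y v) (fderiv ℝ φ y w))⁻¹ := by
  rw [← hU.mul_upperMatrix hy v w, Matrix.mul_nonsing_inv_cancel_right _ _ h]

theorem eqOn (hρ : IsDefiningFunctionOn M W ρ) (hα : IsAdaptedCoframe M W ρ α)
    (hφ : IsHolomorphicImmersion M φ) (hU : IsLift W α φ U) (hU' : IsLift W α φ U') :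
    Set.EqOn U U' (bidisk ∩ φ ⁻¹' W) := by
  intro y hy
  obtain ⟨f, hf0, hf1⟩ := exists_upper_eq hρ hα hφ hy 1 0
  obtain ⟨g, hg0, hg1⟩ := exists_upper_eq hρ hα hφ hy 0 1
  have h : IsUnit (upperMatrix α (φ y) (fderiv ℝ φ y f) (fderiv ℝ φ y g)).det := by
    rw [upperMatrix, Matrix.det_fin_two_of, hf0, hf1, hg0, hg1]
    simp
  rw [hU.eq_lower_mul_upper_inv hy h, hU'.eq_lower_mul_upper_inv hy h]

/-- Cramer's rule with `f`, `g` kept constant: their determinant `D` is 1 at `y`, hence nonzero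
nearby. -/
theorem contDiffAt (hρ : IsDefiningFunctionOn M W ρ) (hα : IsAdaptedCoframe M W ρ α)
    (hφ : IsHolomorphicImmersion M φ) (hU : IsLift W α φ U) (hy : y ∈ bidisk ∩ φ ⁻¹' W)
    (i j : Fin 2) : ContDiffAt ℝ ∞ (fun x => U x i j) y := by
  obtain ⟨f, hf0, hf1⟩ := exists_upper_eq hρ hα hφ hy 1 0
  obtain ⟨g, hg0, hg1⟩ := exists_upper_eq hρ hα hφ hy 0 1
  have hsm : ∀ i v, ContDiffAt ℝ ∞ (fun x => α i (φ x) (fderiv ℝ φ x v)) y := fun i v =>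
    ((IsAdaptedCoframe.contDiffAt hρ hα hy.2 i).comp y (hφ.contDiffAt hy.1)).clm_apply
      (((hφ.contDiffAt hy.1).fderiv_right (m := ∞) (by simp)).clm_apply contDiffAt_const)
  set a : Fin 4 → ℂ × ℂ → ℂ := fun i x => α i (φ x) (fderiv ℝ φ x f) with ha
  set b : Fin 4 → ℂ × ℂ → ℂ := fun i x => α i (φ x) (fderiv ℝ φ x g) with hb
  have hsa : ∀ i, ContDiffAt ℝ ∞ (a i) y := fun i => hsm i f
  have hsb : ∀ i, ContDiffAt ℝ ∞ (b i) y := fun i => hsm i g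
  let D : ℂ × ℂ → ℂ := fun x => a 0 x * b 1 x - b 0 x * a 1 x
  have hD : ContDiffAt ℝ ∞ D y := ((hsa 0).mul (hsb 1)).sub ((hsb 0).mul (hsa 1))
  have hDy : D y ≠ 0 := by
    simp [D, ha, hb, hf0, hf1, hg0, hg1]
  have hev : ∀ᶠ x in nhds y, D x ≠ 0 ∧ x ∈ bidisk ∩ φ ⁻¹' W :=
    (hD.continuousAt.eventually_ne hDy).and ((isOpen_domain hρ hφ).mem_nhds hy)
  have hlow : ∀ x ∈ bidisk ∩ φ ⁻¹' W,
      (a 2 x = U x 0 0 * a 0 x + U x 0 1 * a 1 x ∧ a 3 x = U x 1 0 * a 0 x + U x 1 1 * a 1 x) ∧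
      (b 2 x = U x 0 0 * b 0 x + U x 0 1 * b 1 x ∧ b 3 x = U x 1 0 * b 0 x + U x 1 1 * b 1 x) :=
    fun x hx => ⟨hU.lower_apply hx f, hU.lower_apply hx g⟩
  have hrow : ∀ (i : Fin 2) (k : Fin 4),
      (∀ x ∈ bidisk ∩ φ ⁻¹' W, a k x = U x i 0 * a 0 x + U x i 1 * a 1 x ∧
        b k x = U x i 0 * b 0 x + U x i 1 * b 1 x) →
      ∀ j, ContDiffAt ℝ ∞ (fun x => U x i j) y := by
    intro i k h j
    fin_cases j
    · have hs : ContDiffAt ℝ ∞ (fun x => (a k x * b 1 x - b k x * a 1 x) * (D x)⁻¹) y :=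
        (((hsa k).mul (hsb 1)).sub ((hsb k).mul (hsa 1))).mul (hD.inv hDy)
      refine hs.congr_of_eventuallyEq ?_
      filter_upwards [hev] with x hx
      obtain ⟨h1, h2⟩ := h x hx.2
      refine (eq_mul_inv_iff_mul_eq₀ hx.1).2 ?_
      simp only [D, h1, h2, Fin.zero_eta]
      ring
    · have hs : ContDiffAt ℝ ∞ (fun x => (a 0 x * b k x - b 0 x * a k x) * (D x)⁻¹) y :=
        (((hsa 0).mul (hsb k)).sub ((hsb 0).mul (hsa k))).mul (hD.inv hDy)
      refine hs.congr_of_eventuallyEq ?_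
      filter_upwards [hev] with x hx
      obtain ⟨h1, h2⟩ := h x hx.2
      refine (eq_mul_inv_iff_mul_eq₀ hx.1).2 ?_
      simp only [D, h1, h2, Fin.mk_one]
      ring
  fin_cases i
  · exact hrow 0 2 (fun x hx => ⟨(hlow x hx).1.1, (hlow x hx).2.1⟩) j
  · exact hrow 1 3 (fun x hx => ⟨(hlow x hx).1.2, (hlow x hx).2.2⟩) j

end IsLift

end Lift

/-! ### Vanishing of the torsion along the lift -/

section LiftTorsion

open IsHolomorphicImmersion

variable {M W : Set C5} {ρ : C5 → ℝ} {α : Fin 4 → C5 → Cov} {φ : ℂ × ℂ → C5} {y : ℂ × ℂ}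
  {U : ℂ × ℂ → Matrix (Fin 2) (Fin 2) ℂ}

/-- The entries of the pulled-back Maurer-Cartan form `U* dU`. -/
noncomputable def maurerCartan (U : ℂ × ℂ → Matrix (Fin 2) (Fin 2) ℂ) (y : ℂ × ℂ)
    (k l : Fin 2) (v : ℂ × ℂ) : ℂ :=
  star (U y 0 k) * fderiv ℝ (fun x => U x 0 l) y v +
    star (U y 1 k) * fderiv ℝ (fun x => U x 1 l) y v

namespace IsLift

theorem star_mul_eq (hU : IsLift W α φ U) (hy : y ∈ bidisk ∩ φ ⁻¹' W) (k l : Fin 2) :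
    star (U y 0 k) * U y 0 l + star (U y 1 k) * U y 1 l =
      (1 : Matrix (Fin 2) (Fin 2) ℂ) k l := by
  have h := congrFun (congrFun (Matrix.mem_unitaryGroup_iff'.1 (hU y hy).1) k) l
  rwa [Matrix.mul_apply, Fin.sum_univ_two, Matrix.star_apply, Matrix.star_apply] at h

/-- The derivative of U*U = 1. -/
theorem star_maurerCartan (hρ : IsDefiningFunctionOn M W ρ) (hα : IsAdaptedCoframe M W ρ α)
    (hφ : IsHolomorphicImmersion M φ) (hU : IsLift W α φ U) (hy : y ∈ bidisk ∩ φ ⁻¹' W)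
    (k l : Fin 2) (v : ℂ × ℂ) :
    star (maurerCartan U y l k v) = -maurerCartan U y k l v := by
  have hd : ∀ i j, HasFDerivAt (fun x => U x i j) (fderiv ℝ (fun x => U x i j) y) y := fun i j =>
    ((hU.contDiffAt hρ hα hφ hy i j).differentiableAt (by simp)).hasFDerivAt
  have h1 := (((hd 0 k).star.mul (hd 0 l)).add ((hd 1 k).star.mul (hd 1 l))).fderiv
  have h2 : (fun x => star (U x 0 k) * U x 0 l + star (U x 1 k) * U x 1 l) =ᶠ[nhds y]
      fun _ => (1 : Matrix (Fin 2) (Fin 2) ℂ) k l := by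
    filter_upwards [(isOpen_domain hρ hφ).mem_nhds hy] with x hx
    exact hU.star_mul_eq hx k l
  have h3 := congrArg (fun L => L v) (h1.symm.trans h2.fderiv_eq)
  simp only [fderiv_fun_const, Pi.zero_apply, zero_apply, add_apply, smul_apply, smul_eq_mul,
    ContinuousLinearMap.comp_apply] at h3
  have hst : ∀ c : ℂ, ((starL' ℝ : ℂ ≃L[ℝ] ℂ) : ℂ →L[ℝ] ℂ) c = star c := fun _ => rfl
  simp only [hst] at h3
  simp only [maurerCartan, star_add, star_mul', star_star]
  linear_combination h3

/-- With a = (α¹, α²)ᵀ and b = (α³, α⁴)ᵀ pulled back, b = Ua gives db = dU∧a + U da, hence U*db − da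
= U*dU∧a. -/
theorem torsionForm_eq (hρ : IsDefiningFunctionOn M W ρ) (hα : IsAdaptedCoframe M W ρ α)
    (hφ : IsHolomorphicImmersion M φ) (hU : IsLift W α φ U) (hy : y ∈ bidisk ∩ φ ⁻¹' W)
    (k : Fin 2) (u v : ℂ × ℂ) :
    torsionForm α (φ y) (U y) k (fderiv ℝ φ y u) (fderiv ℝ φ y v) =
      maurerCartan U y k 0 u * α 0 (φ y) (fderiv ℝ φ y v) -
        maurerCartan U y k 0 v * α 0 (φ y) (fderiv ℝ φ y u) +
      (maurerCartan U y k 1 u * α 1 (φ y) (fderiv ℝ φ y v) -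
        maurerCartan U y k 1 v * α 1 (φ y) (fderiv ℝ φ y u)) := by
  have hd : ∀ i j, HasFDerivAt (fun x => U x i j) (fderiv ℝ (fun x => U x i j) y) y := fun i j =>
    ((hU.contDiffAt hρ hα hφ hy i j).differentiableAt (by simp)).hasFDerivAt
  have hφ2 : ContDiffAt ℝ 2 φ y := (hφ.contDiffAt hy.1).of_le (by norm_cast)
  have hαd := fun i => IsAdaptedCoframe.differentiableAt hρ hα hy.2 i
  have hp : ∀ i v, HasFDerivAt (fun x => α i (φ x) (fderiv ℝ φ x v))
      (fderiv ℝ (fun x => α i (φ x) (fderiv ℝ φ x v)) y) y := fun i v =>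
    (hasFDerivAt_pullback (hαd i) hφ2 v).differentiableAt.hasFDerivAt
  have key : ∀ (r : Fin 2) (i : Fin 4),
      (∀ x ∈ bidisk ∩ φ ⁻¹' W, ∀ v, α i (φ x) (fderiv ℝ φ x v) =
        U x r 0 * α 0 (φ x) (fderiv ℝ φ x v) + U x r 1 * α 1 (φ x) (fderiv ℝ φ x v)) →
      ∀ u v, fderiv ℝ (fun x => α i (φ x) (fderiv ℝ φ x v)) y u =
        U y r 0 * fderiv ℝ (fun x => α 0 (φ x) (fderiv ℝ φ x v)) y u +
        fderiv ℝ (fun x => U x r 0) y u * α 0 (φ y) (fderiv ℝ φ y v) +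
        (U y r 1 * fderiv ℝ (fun x => α 1 (φ x) (fderiv ℝ φ x v)) y u +
        fderiv ℝ (fun x => U x r 1) y u * α 1 (φ y) (fderiv ℝ φ y v)) := by
    intro r i h u v
    have h1 : (fun x => α i (φ x) (fderiv ℝ φ x v)) =ᶠ[nhds y] fun x =>
        U x r 0 * α 0 (φ x) (fderiv ℝ φ x v) + U x r 1 * α 1 (φ x) (fderiv ℝ φ x v) := by
      filter_upwards [(isOpen_domain hρ hφ).mem_nhds hy] with x hx using h x hx v
    have h2 := (((hd r 0).mul (hp 0 v)).add ((hd r 1).mul (hp 1 v))).fderiv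
    have h3 := congrArg (fun L => L u) (h1.fderiv_eq.trans h2)
    simp only [add_apply, smul_apply, smul_eq_mul] at h3
    linear_combination h3
  have k2 := key 0 2 fun x hx v => (hU.lower_apply hx v).1
  have k3 := key 1 3 fun x hx v => (hU.lower_apply hx v).2
  have hs := hU.star_mul_eq hy k
  have hs0 := hs 0
  have hs1 := hs 1
  unfold torsionForm maurerCartan
  rw [dForm_pullback (hαd 2) hφ2, dForm_pullback (hαd 3) hφ2, k2 u v, k2 v u, k3 u v, k3 v u,
    Matrix.star_apply, Matrix.star_apply]
  have h0 := dForm_pullback (hαd 0) hφ2 u v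
  have h1 := dForm_pullback (hαd 1) hφ2 u v
  obtain rfl | rfl : k = 0 ∨ k = 1 := by omega
  · simp only [Matrix.one_apply_eq, ne_eq, zero_ne_one, not_false_eq_true,
      Matrix.one_apply_ne, Matrix.cons_val_zero] at hs0 hs1 ⊢
    rw [h0]
    linear_combination
      (fderiv ℝ (fun x => α 0 (φ x) (fderiv ℝ φ x v)) y u -
        fderiv ℝ (fun x => α 0 (φ x) (fderiv ℝ φ x u)) y v) * hs0 +
      (fderiv ℝ (fun x => α 1 (φ x) (fderiv ℝ φ x v)) y u -
        fderiv ℝ (fun x => α 1 (φ x) (fderiv ℝ φ x u)) y v) * hs1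
  · simp only [Matrix.one_apply_eq, ne_eq, one_ne_zero, not_false_eq_true,
      Matrix.one_apply_ne, Matrix.cons_val_one, Matrix.cons_val_fin_one] at hs0 hs1 ⊢
    rw [h1]
    linear_combination
      (fderiv ℝ (fun x => α 0 (φ x) (fderiv ℝ φ x v)) y u -
        fderiv ℝ (fun x => α 0 (φ x) (fderiv ℝ φ x u)) y v) * hs0 +
      (fderiv ℝ (fun x => α 1 (φ x) (fderiv ℝ φ x v)) y u -
        fderiv ℝ (fun x => α 1 (φ x) (fderiv ℝ φ x u)) y v) * hs1

/-- The lift of a holomorphic immersion takes values in the zero set of `T₁` and `T₂`. -/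
theorem torsion_eq_zero (hρ : IsDefiningFunctionOn M W ρ) (hα : IsAdaptedCoframe M W ρ α)
    (hφ : IsHolomorphicImmersion M φ) {t : C5 → Matrix (Fin 2) (Fin 2) ℂ → Torsion}
    (ht : IsTorsion M W ρ α t) (hU : IsLift W α φ U) (hy : y ∈ bidisk ∩ φ ⁻¹' W) :
    T1 (t (φ y) (U y)) = 0 ∧ T2 (t (φ y) (U y)) = 0 := by
  have hint : ∀ v, IsIntegralVector ρ α (φ y) (U y) (fderiv ℝ φ y v) := fun v =>
    ⟨mem_complexTangent hρ hφ hy v, ((hU y hy).2 v).1, ((hU y hy).2 v).2⟩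
  have key := fun u v => ht.eq_combo hρ hα (hφ.mem_inter hy) (hU y hy).1 (hint u) (hint v)
  simp only [hU.torsionForm_eq hρ hα hφ hy, combo_apply] at key
  have hI := Complex.I_mul_I
  obtain ⟨f, hf0, hf1⟩ := exists_upper_eq hρ hα hφ hy 1 0
  -- `f'` and `g'` are the preimages of i times the images of `f` and `g`.
  obtain ⟨f', hf0', hf1'⟩ := exists_upper_eq hρ hα hφ hy Complex.I 0
  obtain ⟨g, hg0, hg1⟩ := exists_upper_eq hρ hα hφ hy 0 1
  obtain ⟨g', hg0', hg1'⟩ := exists_upper_eq hρ hα hφ hy 0 Complex.I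
  have h1 := key f f'
  have h2 := key g g'
  have h3 := key f g
  have h4 := key f g'
  have h5 := key f' g
  have hskew := hU.star_maurerCartan hρ hα hφ hy
  simp only [hf0, hf1, hf0', hf1', hg0, hg1, hg0', hg1', star_zero, star_one,
    Complex.star_def, Complex.conj_I] at h1 h2 h3 h4 h5
  have hsI : star Complex.I = -Complex.I := Complex.conj_I
  have hs2 : star (2 : ℂ) = 2 := Complex.conj_ofNat 2
  obtain ⟨_, h1F⟩ := h1
  obtain ⟨h2D, _⟩ := h2
  obtain ⟨h3, h3'⟩ := h3
  obtain ⟨h4, h4'⟩ := h4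
  obtain ⟨h5, h5'⟩ := h5
  generalize t (φ y) (U y) = τ at *
  generalize hm : maurerCartan U y = m at *
  have q4 : -τ.B - τ.C + τ.E = m 0 1 f + Complex.I * m 0 0 g' := by
    linear_combination Complex.I * h4 + (-τ.B - τ.C + τ.E - m 0 1 f) * hI
  have q4' : -τ.G - τ.H + τ.J = m 1 1 f + Complex.I * m 1 0 g' := by
    linear_combination Complex.I * h4' + (-τ.G - τ.H + τ.J - m 1 1 f) * hI
  have q5 : τ.B + τ.C + τ.E = -Complex.I * m 0 1 f' - m 0 0 g := by
    linear_combination Complex.I * h5 + (τ.B + τ.C + τ.E + m 0 0 g) * hI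
  have q5' : τ.G + τ.H + τ.J = -Complex.I * m 1 1 f' - m 1 0 g := by
    linear_combination Complex.I * h5' + (τ.G + τ.H + τ.J + m 1 0 g) * hI
  -- (m(g) + i m(g'))/2 is the ᾱ²-coefficient of m and (m(g) − i m(g'))/2 its α²-coefficient;
  -- likewise `f`, `f'` for α¹.
  have hB : τ.B = -(m 0 0 g + Complex.I * m 0 0 g') / 2 := by
    linear_combination -(h3 + q4) / 2
  have hE : τ.E = (m 0 1 f + Complex.I * m 0 0 g' - Complex.I * m 0 1 f' - m 0 0 g) / 2 := by
    linear_combination (q4 + q5) / 2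
  have hF : τ.F = -(m 1 0 f + Complex.I * m 1 0 f') / 2 := by
    linear_combination -(Complex.I / 2) * h1F + (τ.F + m 1 0 f / 2) * hI
  have hD : τ.D = -(m 0 1 g + Complex.I * m 0 1 g') / 2 := by
    linear_combination -(Complex.I / 2) * h2D + (τ.D + m 0 1 g / 2) * hI
  have hJ : τ.J = (m 1 1 f + Complex.I * m 1 0 g' - Complex.I * m 1 1 f' - m 1 0 g) / 2 := by
    linear_combination (q4' + q5') / 2
  have hH : τ.H = -(m 1 1 f + Complex.I * m 1 1 f') / 2 := by
    linear_combination (q5' + h3') / 2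
  constructor
  · simp only [T1, hB, hE, hF, star_div₀, star_neg, star_add, star_mul', hskew, hsI, hs2]
    ring
  · simp only [T2, hD, hJ, hH, star_div₀, star_neg, star_add, star_mul', hskew, hsI, hs2]
    ring

end IsLift

end LiftTorsion

end CRBidisk

open CRBidisk in
theorem theorem3p20 (M : Set C5) (hM : IsRealAnalyticHypersurface M) (h0 : (0 : C5) ∈ M)
    (hLevi : HasLeviSignature22 M)
    -- a defining function of `M` and an adapted coframe on `M ∩ W`
    (W : Set C5) (ρ : C5 → ℝ) (hρ : IsDefiningFunctionOn M W ρ)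
    (α : Fin 4 → C5 → Cov) (hα : IsAdaptedCoframe M W ρ α)
    (φ : ℂ × ℂ → C5) (hφ : IsHolomorphicImmersion M φ) (hφ0 : φ 0 = 0) :
    -- the torsion functions exist on `(M ∩ W) × U(2)` and are unique there
    (∃ t, IsTorsion M W ρ α t) ∧
    (∀ t t', IsTorsion M W ρ α t → IsTorsion M W ρ α t' →
      ∀ z ∈ M ∩ W, ∀ U ∈ Matrix.unitaryGroup (Fin 2) ℂ, t z U = t' z U) ∧
    -- the lift exists, is smooth, and is unique
    (∃ U, IsLift W α φ U ∧ ∀ i j, ContDiffOn ℝ ∞ (fun y => U y i j) (bidisk ∩ φ ⁻¹' W)) ∧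
    (∀ U U', IsLift W α φ U → IsLift W α φ U' → Set.EqOn U U' (bidisk ∩ φ ⁻¹' W)) ∧
    -- it is given by the values of the coframe on any two vectors that span the tangent plane
    (∀ U, IsLift W α φ U → ∀ y ∈ bidisk ∩ φ ⁻¹' W, ∀ v w,
      LinearIndependent ℂ ![fderiv ℝ φ y v, fderiv ℝ φ y w] →
        IsUnit (upperMatrix α (φ y) (fderiv ℝ φ y v) (fderiv ℝ φ y w)).det ∧
        U y = lowerMatrix α (φ y) (fderiv ℝ φ y v) (fderiv ℝ φ y w) *
          (upperMatrix α (φ y) (fderiv ℝ φ y v) (fderiv ℝ φ y w))⁻¹) ∧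
    -- its image lies in the common zero set of `T₁` and `T₂`
    (∀ t U, IsTorsion M W ρ α t → IsLift W α φ U →
      ∀ y ∈ bidisk ∩ φ ⁻¹' W, T1 (t (φ y) (U y)) = 0 ∧ T2 (t (φ y) (U y)) = 0) := by
  refine ⟨exists_isTorsion hρ hα, fun t t' ht ht' z hz U hU => ht.unique hρ hα ht' hz hU, ?_,
    fun U U' hU hU' => hU.eqOn hρ hα hφ hU', fun U hU y hy v w h => ?_,
    fun t U ht hU y hy => hU.torsion_eq_zero hρ hα hφ ht hy⟩
  · obtain ⟨U, hU⟩ := hφ.exists_isLift hρ hα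
    exact ⟨U, hU, fun i j y hy => (hU.contDiffAt hρ hα hφ hy i j).contDiffWithinAt⟩
  · have hdet := hφ.isUnit_det_upperMatrix hρ hα hy h
    exact ⟨hdet, hU.eq_lower_mul_upper_inv hy hdet⟩
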